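/- **Setting.** Let $d\ge 1$ and $\mathcal D_0=\mathcal D(\mathbb R^d)$, the space of complex-valued test functions. For $\varphi\in\mathcal D_0$ let $R_\varphi=\sup\{\|x\|:\varphi(x)\ne0\}$ if $\varphi\neq0$, and $R_0=1$. For $n\ge1$ let $\mathcal D_n$ be the set of all real-valued $\varphi\in\mathcal D_0$ with $\varphi(-x)=\varphi(x)$, $R_\varphi\le 1/n$, $\int\varphi=1$, $\int x^\alpha\varphi(x)\,dx=0$ for $1\le|\alpha|\le n$, $\int|\varphi|\le 1+1/n$, and $\sup|\partial^\alpha\varphi|\le R_\varphi^{-2(|\alpha|+d)}$ for $|\alpha|\le n$. Let $\mathcal U$ be an ultrafilter on $\mathcal D_0$ with $\mathcal D_n\in\mathcal U$ for all $n\ge 0$; "a.e." means "for all $\varphi$ in some member of $\mathcal U$". The ring $\widehat{\mathbb C^{\mathcal D_0}}$ of asymptotic numbers consists of the nets $(A_\varphi)_{\varphi\in\mathcal D_0}$ in $\mathbb C$ that are moderate ($\exists m:\ |A_\varphi|\le R_\varphi^{-m}$ a.e.), modulo the negligible ones ($\forall p:\ |A_\varphi|<R_\varphi^{p}$ a.e.);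 $\mathbb C\subset\widehat{\mathbb C^{\mathcal D_0}}$ by constant nets. For an open set $\Omega\subseteq\mathbb R^d$ let $\mathcal E(\Omega)=C^\infty(\Omega,\mathbb C)$. The algebra $\widehat{\mathcal E(\Omega)^{\mathcal D_0}}$ of asymptotic functions consists of the nets $(f_\varphi)_{\varphi\in\mathcal D_0}$ in $\mathcal E(\Omega)$ that are moderate ($\forall K\Subset\Omega\ \forall\alpha\ \exists m:\ \sup_K|\partial^\alpha f_\varphi|\le R_\varphi^{-m}$ a.e.), modulo the negligible ones ($\forall K\Subset\Omega\ \forall\alpha\ \forall p:\ \sup_K|\partial^\alpha f_\varphi|\le R_\varphi^{p}$ a.e.). The class of $(f_\varphi)$ is written $\widehat{f_\varphi}$. The operations, the derivatives $\partial^\alpha$, the restriction to open subsets and the pairing $(\widehat{f_\varphi}\,|\,\tau)=\widehat{\int_\Omega f_\varphi\tau}\in\widehat{\mathbb C^{\mathcal D_0}}$ with $\tau\in\mathcal D(\Omega)$ are defined on representatives. Let $\widetilde\Omega_\varphi=\{x\in\Omega: d(x,\partial\Omega)>2R_\varphi,\ \|x\|<1/R_\varphi\}$ (with $d(x,\varnothing)=\infty$)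 and $C_{\Omega,\varphi}(x)=\int_{\widetilde\Omega_\varphi}\varphi(x-t)\,dt$. For $T\in\mathcal D'(\Omega)$ let $(T\circledast\varphi)(x)=\big(T(t)\,\big|\,C_{\Omega,\varphi}(t)\varphi(x-t)\big)$, $x\in\Omega$. Define $$\sigma_\Omega:\mathcal E(\Omega)\to\widehat{\mathcal E(\Omega)^{\mathcal D_0}},\ \sigma_\Omega(f)=\widehat f,\qquad E_\Omega:\mathcal D'(\Omega)\to\widehat{\mathcal E(\Omega)^{\mathcal D_0}},\ E_\Omega(T)=\widehat{T\circledast\varphi}.$$ Let $L_\Omega:\mathcal L_{loc}(\Omega)\to\mathcal D'(\Omega)$, $(L_\Omega f|\tau)=\int_\Omega f\tau$, where $\mathcal L_{loc}(\Omega)$ is the space of locally integrable complex functions on $\Omega$ modulo equality almost everywhere (with respect to Lebesgue measure). **Theorem 5.3 (Properties of Embedding).** Let $\Omega\subseteq\mathbb R^d$ be open. For every $T\in\mathcal D'(\Omega)$ the net $(T\circledast\varphi)$ is a moderate net in $\mathcal E(\Omega)$, so that $E_\Omega$ is well defined, and: (i) $(E_\Omega\circ L_\Omega)(f)=\sigma_\Omega(f)$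 for all $f\in\mathcal E(\Omega)$. Consequently $(E_\Omega\circ L_\Omega)[\mathcal E(\Omega)]$ is a differential subalgebra of $\widehat{\mathcal E(\Omega)^{\mathcal D_0}}$ over $\mathbb C$, and $E_\Omega\circ L_\Omega$ is an isomorphism of differential algebras over $\mathbb C$ from $\mathcal E(\Omega)$ onto it. Moreover $\int_\Omega f\tau\,dx=(\sigma_\Omega(f)|\tau)=((E_\Omega\circ L_\Omega)(f)|\tau)$ for all $f\in\mathcal E(\Omega)$, $\tau\in\mathcal D(\Omega)$, and $E_\Omega\circ L_\Omega=\sigma_\Omega$ is injective on $\mathcal E(\Omega)$. (ii) $E_\Omega$ is $\mathbb C$-linear, $E_\Omega(\partial^\alpha T)=\partial^\alpha E_\Omega(T)$ for all multi-indices $\alpha$ and all $T\in\mathcal D'(\Omega)$, $(T|\tau)=(E_\Omega(T)|\tau)$ for all $T\in\mathcal D'(\Omega)$ and $\tau\in\mathcal D(\Omega)$, and $E_\Omega$ is injective. (iii) $E_\Omega\circ L_\Omega:\mathcal L_{loc}(\Omega)\to\widehat{\mathcal E(\Omega)^{\mathcal D_0}}$ is $\mathbb C$-linear and injective, and $\int_\Omega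 f\tau\,dx=((E_\Omega\circ L_\Omega)(f)|\tau)$ for all $f\in\mathcal L_{loc}(\Omega)$ and $\tau\in\mathcal D(\Omega)$. (iv) $\sigma_\Omega$, $E_\Omega$ and $E_\Omega\circ L_\Omega$ preserve restrictions: for every open $\mathcal O\subseteq\Omega$, $\sigma_\Omega(f)|_{\mathcal O}=\sigma_{\mathcal O}(f|_{\mathcal O})$, $E_\Omega(T)|_{\mathcal O}=E_{\mathcal O}(T|_{\mathcal O})$ and $(E_\Omega\circ L_\Omega)(f)|_{\mathcal O}=(E_{\mathcal O}\circ L_{\mathcal O})(f|_{\mathcal O})$ for all $f$ in $\mathcal E(\Omega)$, $T$ in $\mathcal D'(\Omega)$ and $f$ in $\mathcal L_{loc}(\Omega)$, respectively. -/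

import Mathlib

open TopologicalSpace MeasureTheory Filter
open scoped Distributions ContDiff Topology

noncomputable section

namespace AsymptoticFunctions

variable {d : ℕ}

/-- `ℝ^d` with the Euclidean norm. -/
abbrev Eucl (d : ℕ) : Type := EuclideanSpace ℝ (Fin d)

/-- The `i`-th standard basis vector of `ℝ^d`. -/
def basisVec (i : Fin d) : Eucl d := EuclideanSpace.single i (1 : ℝ)

/-! ### Multi-indices and iterated partial derivatives -/

/-- The length `|α|` of a multi-index. -/
def absIdx (α : Fin d → ℕ) : ℕ := ∑ i, α i

/-- Given operators `D 0, …, D (d-1)` (the partial derivatives on some space), the operator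
`∂^α = (D 0)^(α 0) ∘ (D 1)^(α 1) ∘ ⋯ ∘ (D (d-1))^(α (d-1))`. -/
def multiIter {A : Type*} (D : Fin d → A → A) (α : Fin d → ℕ) (a : A) : A :=
  (List.finRange d).foldr (fun i b => (D i)^[α i] b) a

/-- The multi-index `α + e_j`. -/
def bumpIdx (α : Fin d → ℕ) (j : Fin d) : Fin d → ℕ := fun i => α i + if i = j then 1 else 0

theorem multiIter_zero {A : Type*} (D : Fin d → A → A) (a : A) :
    multiIter D 0 a = a := by
  unfold multiIter
  induction List.finRange d with
  | nil => rfl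
  | cons i l ih => simp

theorem multiIter_add_single {A : Type*} (D : Fin d → A → A)
    (hD : ∀ i j a, D i (D j a) = D j (D i a)) (α : Fin d → ℕ) (j : Fin d) (a : A) :
    multiIter D (bumpIdx α j) a = multiIter D α (D j a) := by
  have hcomm : ∀ i k a, (D i)^[k] (D j a) = D j ((D i)^[k] a) := fun i k a =>
    (Function.Commute.iterate_left (f := D i) (g := D j) (fun a => hD i j a) k) a
  have h1 : ∀ (l : List (Fin d)) (a : A),
      l.foldr (fun i b => (D i)^[α i] b) (D j a) = D j (l.foldr (fun i b => (D i)^[α i] b) a) := by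
    intro l a
    induction l with
    | nil => rfl
    | cons i l ih => simp only [List.foldr_cons, ih, hcomm]
  have h2 : ∀ (l : List (Fin d)), j ∉ l →
      l.foldr (fun i b => (D i)^[bumpIdx α j i] b) a
        = l.foldr (fun i b => (D i)^[α i] b) a := by
    intro l hl
    induction l with
    | nil => rfl
    | cons i l ih =>
      simp only [List.mem_cons, not_or] at hl
      have : bumpIdx α j i = α i := by simp [bumpIdx, Ne.symm hl.1]
      simp only [List.foldr_cons, ih hl.2, this]
  have h3 : ∀ (l : List (Fin d)), l.Nodup → j ∈ l →
      l.foldr (fun i b => (D i)^[bumpIdx α j i] b) a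
        = D j (l.foldr (fun i b => (D i)^[α i] b) a) := by
    intro l hl hj
    induction l with
    | nil => simp at hj
    | cons i l ih =>
      rw [List.nodup_cons] at hl
      simp only [List.foldr_cons]
      by_cases hij : i = j
      · subst hij
        rw [h2 l hl.1]
        simp [bumpIdx, Function.iterate_succ_apply']
      · have hjl : j ∈ l := by
          rcases List.mem_cons.1 hj with h | h
          · exact absurd h.symm hij
          · exact h
        have : bumpIdx α j i = α i := by simp [bumpIdx, hij]
        rw [ih hl.2 hjl, this, hcomm]
  unfold multiIter
  rw [h1, h3 _ (List.nodup_finRange d) (List.mem_finRange j)]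

/-- The linear map on `N` induced by a linear map `F` on `M`, where `π : M → N` is a surjective
linear map whose kernel is contained in the kernel of `F`. -/
def descend {M N A : Type} [AddCommGroup M] [Module ℂ M] [AddCommGroup N] [Module ℂ N]
    [AddCommGroup A] [Module ℂ A] (π : M →ₗ[ℂ] N) (hπ : Function.Surjective π) (F : M →ₗ[ℂ] A)
    (hF : ∀ m, π m = 0 → F m = 0) : N →ₗ[ℂ] A :=
  have key : ∀ m, F (Function.surjInv hπ (π m)) = F m := fun m => by
    rw [← sub_eq_zero, ← map_sub]
    exact hF _ (by rw [map_sub, Function.surjInv_eq hπ, sub_self])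
  { toFun := fun a => F (Function.surjInv hπ a)
    map_add' := fun a b => by
      obtain ⟨m, rfl⟩ := hπ a
      obtain ⟨n, rfl⟩ := hπ b
      rw [← map_add, key, key, key, map_add]
    map_smul' := fun c a => by
      obtain ⟨m, rfl⟩ := hπ a
      rw [← map_smul, key, key, map_smul, RingHom.id_apply] }

theorem descend_apply {M N A : Type} [AddCommGroup M] [Module ℂ M] [AddCommGroup N] [Module ℂ N]
    [AddCommGroup A] [Module ℂ A] (π : M →ₗ[ℂ] N) (hπ : Function.Surjective π) (F : M →ₗ[ℂ] A)
    (hF : ∀ m, π m = 0 → F m = 0) (m : M) : descend π hπ F hF (π m) = F m := by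
  change F (Function.surjInv hπ (π m)) = F m
  rw [← sub_eq_zero, ← map_sub]
  exact hF _ (by rw [map_sub, Function.surjInv_eq hπ, sub_self])

/-! ### Test functions on `ℝ^d`, the radius of support, the directing sequence -/

/-- `𝒟(ℝ^d)`, the index set of all nets. -/
abbrev TestFn (d : ℕ) : Type := 𝓓((⊤ : Opens (Eucl d)), ℂ)

/-- The partial derivative `∂_i` on the space `𝒟(Ω)` of test functions. -/
def testPartial (Ω : Opens (Eucl d)) (i : Fin d) : 𝓓(Ω, ℂ) →L[ℂ] 𝓓(Ω, ℂ) :=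
  TestFunction.lineDerivCLM ℂ (basisVec i)

open Classical in
/-- The radius of support `R_φ` (equal to `1` for `φ = 0`). -/
def suppRadius (φ : TestFn d) : ℝ :=
  if φ = 0 then 1 else sSup {r : ℝ | ∃ x : Eucl d, φ x ≠ 0 ∧ r = ‖x‖}

/-- The directing sequence: `𝒟_0` is everything, and for `n ≥ 1` the set `𝒟_n` consists of the
real-valued, even test functions of integral one, with small support, vanishing moments of orders
`1, …, n`, and with the stated bounds on the `L¹`-norm and on the derivatives. -/
def directingSet (d n : ℕ) : Set (TestFn d) :=
  {φ | 1 ≤ n →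
    (∀ x, (φ x).im = 0) ∧
    (∀ x, φ (-x) = φ x) ∧
    suppRadius φ ≤ 1 / (n : ℝ) ∧
    ∫ x, φ x = 1 ∧
    (∀ α : Fin d → ℕ, 1 ≤ absIdx α → absIdx α ≤ n →
      ∫ x : Eucl d, ((∏ i, x i ^ α i : ℝ) : ℂ) * φ x = 0) ∧
    ∫ x, ‖φ x‖ ≤ 1 + 1 / (n : ℝ) ∧
    (∀ α : Fin d → ℕ, absIdx α ≤ n → ∀ x,
      ‖multiIter (fun i => testPartial ⊤ i) α φ x‖ ≤ (suppRadius φ)⁻¹ ^ (2 * (absIdx α + d)))}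

/-- An ultrafilter on `𝒟(ℝ^d)` which contains all the sets `𝒟_n` of the directing sequence. -/
structure DirectingUltrafilter (d : ℕ) where
  /-- the underlying ultrafilter -/
  toUltrafilter : Ultrafilter (TestFn d)
  directingSet_mem : ∀ n : ℕ, directingSet d n ∈ toUltrafilter

/-- `P φ` holds almost everywhere, i.e. the set of all `φ` with `P φ` is in the ultrafilter. -/
def DirectingUltrafilter.AE (U : DirectingUltrafilter d) (P : TestFn d → Prop) : Prop :=
  {φ | P φ} ∈ U.toUltrafilter

theorem norm_le_suppRadius (φ : TestFn d) {x : Eucl d} (hx : φ x ≠ 0) :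
    ‖x‖ ≤ suppRadius φ := by
  have h0 : φ ≠ 0 := by rintro rfl; exact hx rfl
  rw [suppRadius, if_neg h0]
  refine le_csSup ?_ ⟨x, hx, rfl⟩
  obtain ⟨C, hC⟩ := φ.hasCompactSupport.isCompact.isBounded.exists_norm_le
  exact ⟨C, by rintro r ⟨y, hy, rfl⟩; exact hC y (subset_tsupport _ hy)⟩

theorem suppRadius_pos [NeZero d] (φ : TestFn d) : 0 < suppRadius φ := by
  by_cases h0 : φ = 0
  · simp [suppRadius, h0]
  · obtain ⟨x, hx⟩ : ∃ x, φ x ≠ 0 := by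
      by_contra! h
      exact h0 (DFunLike.ext _ _ h)
    have hopen : IsOpen {x | φ x ≠ 0} := isOpen_ne_fun φ.contDiff.continuous continuous_const
    have : Nonempty (Fin d) := ⟨0⟩
    obtain ⟨y, hy, hy0⟩ : ∃ y, φ y ≠ 0 ∧ y ≠ 0 := by
      by_cases hx0 : x = 0
      · have hnb : {x | φ x ≠ 0} ∈ 𝓝[≠] (0 : Eucl d) :=
          mem_nhdsWithin_of_mem_nhds (hopen.mem_nhds (by simpa [hx0] using hx))
        obtain ⟨y, hy⟩ := (inter_mem hnb self_mem_nhdsWithin : _ ∈ 𝓝[≠] (0 : Eucl d)) |>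
          Filter.nonempty_of_mem
        exact ⟨y, hy.1, hy.2⟩
      · exact ⟨x, hx, hx0⟩
    exact (norm_pos_iff.2 hy0).trans_le (norm_le_suppRadius φ hy)

namespace DirectingUltrafilter

variable (U : DirectingUltrafilter d)

theorem AE.mono {U : DirectingUltrafilter d} {P Q : TestFn d → Prop} (h : U.AE P)
    (hPQ : ∀ φ, P φ → Q φ) : U.AE Q := mem_of_superset h hPQ

theorem AE.and {U : DirectingUltrafilter d} {P Q : TestFn d → Prop} (h : U.AE P) (h' : U.AE Q) :
    U.AE (fun φ => P φ ∧ Q φ) := inter_mem h h'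

theorem ae_of_forall {P : TestFn d → Prop} (h : ∀ φ, P φ) : U.AE P :=
  mem_of_superset univ_mem (fun φ _ => h φ)

theorem ae_radius_mul_le (C : ℝ) : U.AE (fun φ => C * suppRadius φ ≤ 1) := by
  obtain ⟨n, hn⟩ := exists_nat_ge (max C 1)
  have hn1 : 1 ≤ n := by exact_mod_cast (le_max_right _ _).trans hn
  refine AE.mono (P := fun φ => φ ∈ directingSet d n) (U.directingSet_mem n) fun φ hφ => ?_
  have hR := (hφ hn1).2.2.1
  have hn0 : (0 : ℝ) < n := by exact_mod_cast hn1
  by_cases hR0 : 0 ≤ suppRadius φ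
  · calc C * suppRadius φ ≤ n * suppRadius φ := by
          gcongr; exact (le_max_left _ _).trans hn
      _ ≤ n * (1 / n) := by gcongr
      _ = 1 := by field_simp
  · exfalso
    apply hR0
    by_cases h0 : φ = 0
    · simp [suppRadius, h0]
    · rw [suppRadius, if_neg h0]
      exact Real.sSup_nonneg (by rintro r ⟨x, -, rfl⟩; exact norm_nonneg _)

end DirectingUltrafilter

/-! ### Asymptotic numbers -/

section Numbers

variable [NeZero d] (U : DirectingUltrafilter d)

theorem DirectingUltrafilter.ae_mul_inv_pow_le (C : ℝ) (m : ℕ) :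
    U.AE (fun φ => C * (suppRadius φ)⁻¹ ^ m ≤ (suppRadius φ)⁻¹ ^ (m + 1)) := by
  refine (U.ae_radius_mul_le C).mono fun φ h => ?_
  have hR := suppRadius_pos φ
  rw [pow_succ' _ m]
  gcongr
  rw [← one_div, le_div_iff₀ hR]
  exact h

theorem DirectingUltrafilter.ae_mul_pow_lt (C : ℝ) (p : ℕ) :
    U.AE (fun φ => C * suppRadius φ ^ (p + 1) < suppRadius φ ^ p) := by
  refine (U.ae_radius_mul_le (2 * C)).mono fun φ h => ?_
  have hR := suppRadius_pos φ
  have h1 : C * suppRadius φ < 1 := by linarith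
  calc C * suppRadius φ ^ (p + 1) = (C * suppRadius φ) * suppRadius φ ^ p := by ring
    _ < 1 * suppRadius φ ^ p := by gcongr
    _ = _ := one_mul _

theorem one_le_inv_suppRadius (φ : TestFn d) (h : 1 * suppRadius φ ≤ 1) :
    1 ≤ (suppRadius φ)⁻¹ := by
  have hR := suppRadius_pos φ
  exact (one_le_inv₀ hR).2 (by simpa using h)

/-- The moderate nets of complex numbers:
there is `m` such that `|A_φ| ≤ R_φ^(-m)` almost everywhere. -/
def moderateNum : Subalgebra ℂ (TestFn d → ℂ) where
  carrier := {A | ∃ m : ℕ, U.AE (fun φ => ‖A φ‖ ≤ (suppRadius φ)⁻¹ ^ m)}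
  mul_mem' := by
    rintro A B ⟨m, hm⟩ ⟨k, hk⟩
    refine ⟨m + k, (hm.and hk).mono fun φ h => ?_⟩
    have hR := suppRadius_pos φ
    rw [Pi.mul_apply, norm_mul, pow_add]
    gcongr
    exacts [h.1, h.2]
  add_mem' := by
    rintro A B ⟨m, hm⟩ ⟨k, hk⟩
    refine ⟨m + k + 1, ((hm.and hk).and ((U.ae_radius_mul_le 1).and
      (U.ae_mul_inv_pow_le 2 (m + k)))).mono fun φ h => ?_⟩
    obtain ⟨⟨h1, h2⟩, h3, h4⟩ := h
    have hR := one_le_inv_suppRadius φ h3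
    calc ‖A φ + B φ‖ ≤ (suppRadius φ)⁻¹ ^ m + (suppRadius φ)⁻¹ ^ k :=
          (norm_add_le _ _).trans (add_le_add h1 h2)
      _ ≤ (suppRadius φ)⁻¹ ^ (m + k) + (suppRadius φ)⁻¹ ^ (m + k) := by
          gcongr <;> first | exact hR | omega
      _ ≤ _ := by linarith
  algebraMap_mem' := fun c =>
    ⟨1, (U.ae_mul_inv_pow_le ‖c‖ 0).mono fun φ h => by simpa using h⟩

instance : CommRing (moderateNum U) := (moderateNum U).toCommRing

/-- The negligible nets of complex numbers:
for every `p`, `|A_φ| < R_φ^p` almost everywhere. -/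
def negligibleNum : Ideal (moderateNum U) where
  carrier := {A | ∀ p : ℕ, U.AE (fun φ => ‖(A : TestFn d → ℂ) φ‖ < suppRadius φ ^ p)}
  zero_mem' := fun p => U.ae_of_forall fun φ => by
    simpa using pow_pos (suppRadius_pos φ) p
  add_mem' := by
    intro A B hA hB p
    refine (((hA (p + 1)).and (hB (p + 1))).and (U.ae_mul_pow_lt 2 p)).mono fun φ h => ?_
    obtain ⟨⟨h1, h2⟩, h3⟩ := h
    have := norm_add_le ((A : TestFn d → ℂ) φ) ((B : TestFn d → ℂ) φ)
    simp only [Subalgebra.coe_add, Pi.add_apply]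
    linarith
  smul_mem' := by
    intro A B hB p
    obtain ⟨m, hm⟩ := A.2
    refine (hm.and (hB (p + m))).mono fun φ h => ?_
    have hR := suppRadius_pos φ
    simp only [smul_eq_mul, Subalgebra.coe_mul, Pi.mul_apply, norm_mul]
    calc _ ≤ (suppRadius φ)⁻¹ ^ m * ‖(B : TestFn d → ℂ) φ‖ := by gcongr; exact h.1
      _ < (suppRadius φ)⁻¹ ^ m * suppRadius φ ^ (p + m) := by gcongr; exact h.2
      _ = _ := by rw [pow_add, mul_comm, mul_assoc, ← mul_pow, mul_inv_cancel₀ hR.ne', one_pow,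
            mul_one]

/-- The ring of (complex) asymptotic numbers: moderate nets modulo negligible nets.
The complex numbers are embedded by constant nets, which is `algebraMap ℂ (AsympNum U)`. -/
def AsympNum : Type := moderateNum U ⧸ negligibleNum U

instance : CommRing (AsympNum U) := 
  inferInstanceAs (CommRing (moderateNum U ⧸ negligibleNum U))
instance : Algebra ℂ (AsympNum U) :=
  inferInstanceAs (Algebra ℂ (moderateNum U ⧸ negligibleNum U))

end Numbers

/-! ### Smooth functions -/

open Classical in
/-- Extension by zero of a function on `Ω` to `ℝ^d`. -/
def zeroExt {Ω : Opens (Eucl d)} (f : Ω → ℂ) (x : Eucl d) : ℂ :=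
  if h : x ∈ Ω then f ⟨x, h⟩ else 0

theorem zeroExt_apply {Ω : Opens (Eucl d)} (f : Ω → ℂ) (x : Ω) : zeroExt f x = f x := by
  simp [zeroExt]

theorem zeroExt_of_mem {Ω : Opens (Eucl d)} (f : Ω → ℂ) {x : Eucl d} (h : x ∈ Ω) :
    zeroExt f x = f ⟨x, h⟩ := by
  simp [zeroExt, h]

/-- `ℰ(Ω) = C^∞(Ω)`, the algebra of smooth functions `Ω → ℂ`. -/
def SmoothFn (Ω : Opens (Eucl d)) : Subalgebra ℂ (Ω → ℂ) where
  carrier := {f | ContDiffOn ℝ ∞ (zeroExt f) Ω}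
  mul_mem' := by
    intro f g hf hg
    refine (ContDiffOn.mul hf hg).congr fun x hx => ?_
    simp [zeroExt_of_mem _ hx]
  add_mem' := by
    intro f g hf hg
    refine (ContDiffOn.add hf hg).congr fun x hx => ?_
    simp [zeroExt_of_mem _ hx]
  algebraMap_mem' := fun c => by
    refine (contDiffOn_const (c := c)).congr fun x hx => ?_
    simp [zeroExt_of_mem _ hx]

instance (Ω : Opens (Eucl d)) : CommRing (SmoothFn Ω) := (SmoothFn Ω).toCommRing
instance (Ω : Opens (Eucl d)) : Algebra ℂ (SmoothFn Ω) := (SmoothFn Ω).algebra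

namespace SmoothFn

variable {Ω O : Opens (Eucl d)}

theorem contDiffAt (f : SmoothFn Ω) (x : Ω) : ContDiffAt ℝ ∞ (zeroExt (f : Ω → ℂ)) x :=
  (f.2 : ContDiffOn ℝ ∞ _ _).contDiffAt (Ω.isOpen.mem_nhds x.2)

theorem differentiableAt (f : SmoothFn Ω) (x : Ω) :
    DifferentiableAt ℝ (zeroExt (f : Ω → ℂ)) x :=
  (contDiffAt f x).differentiableAt (by simp)

/-- A function which is smooth on an open set, as an element of `ℰ(Ω)`. -/
def mk' (g : Eucl d → ℂ) (hg : ContDiffOn ℝ ∞ g Ω) : SmoothFn Ω :=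
  ⟨fun x => g x, ContDiffOn.congr hg fun x hx => by simp [zeroExt_of_mem _ hx]⟩

theorem zeroExt_eventuallyEq {f : Ω → ℂ} {F : Eucl d → ℂ} (h : ∀ x : Ω, f x = F x) (x : Ω) :
    zeroExt f =ᶠ[𝓝 (x : Eucl d)] F := by
  filter_upwards [Ω.isOpen.mem_nhds x.2] with y hy
  rw [zeroExt_of_mem _ hy, h]

/-- The partial derivative `∂_i` on `ℰ(Ω)`, as a derivation. -/
def partialDeriv (i : Fin d) : Derivation ℂ (SmoothFn Ω) (SmoothFn Ω) :=
  Derivation.mk'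
    { toFun := fun f => mk' (fun x => fderiv ℝ (zeroExt (f : Ω → ℂ)) x (basisVec i)) <| by
        have h : ContDiffOn ℝ ∞ (fun x => fderiv ℝ (zeroExt (f : Ω → ℂ)) x) Ω :=
          (f.2 : ContDiffOn ℝ ∞ _ _).fderiv_of_isOpen Ω.isOpen (by simp)
        exact h.clm_apply contDiffOn_const
      map_add' := by
        intro f g
        ext x
        have h : zeroExt ((f + g : SmoothFn Ω) : Ω → ℂ) =ᶠ[𝓝 (x : Eucl d)]
            fun y => zeroExt (f : Ω → ℂ) y + zeroExt (g : Ω → ℂ) y :=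
          zeroExt_eventuallyEq (fun y => by simp [zeroExt_apply]) x
        simp only [mk', Subalgebra.coe_add, Pi.add_apply]
        rw [← Subalgebra.coe_add, h.fderiv_eq,
          fderiv_fun_add (differentiableAt f x) (differentiableAt g x)]
        rfl
      map_smul' := by
        intro c f
        ext x
        have h : zeroExt ((c • f : SmoothFn Ω) : Ω → ℂ) =ᶠ[𝓝 (x : Eucl d)]
            fun y => c • zeroExt (f : Ω → ℂ) y :=
          zeroExt_eventuallyEq (fun y => by simp [zeroExt_apply]) x
        simp only [mk', RingHom.id_apply]
        rw [h.fderiv_eq, fderiv_fun_const_smul (differentiableAt f x)]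
        rfl }
    (by
      intro f g
      ext x
      have h : zeroExt ((f * g : SmoothFn Ω) : Ω → ℂ) =ᶠ[𝓝 (x : Eucl d)]
          fun y => zeroExt (f : Ω → ℂ) y * zeroExt (g : Ω → ℂ) y :=
        zeroExt_eventuallyEq (fun y => by simp [zeroExt_apply]) x
      simp only [mk', LinearMap.coe_mk, AddHom.coe_mk, smul_eq_mul, Subalgebra.coe_add,
        Subalgebra.coe_mul, Pi.add_apply, Pi.mul_apply]
      rw [← Subalgebra.coe_mul, h.fderiv_eq,
        fderiv_fun_mul (differentiableAt f x) (differentiableAt g x)]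
      simp [zeroExt_apply])

theorem partialDeriv_apply (i : Fin d) (f : SmoothFn Ω) (x : Ω) :
    (partialDeriv i f : Ω → ℂ) x = fderiv ℝ (zeroExt (f : Ω → ℂ)) x (basisVec i) := rfl

theorem partialDeriv_comm (i j : Fin d) (f : SmoothFn Ω) :
    partialDeriv i (partialDeriv j f) = partialDeriv j (partialDeriv i f) := by
  have key : ∀ (i j : Fin d) (x : Ω), (partialDeriv i (partialDeriv j f) : Ω → ℂ) x
      = fderiv ℝ (fderiv ℝ (zeroExt (f : Ω → ℂ))) x (basisVec i) (basisVec j) := by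
    intro i j x
    have h : zeroExt ((partialDeriv j f : SmoothFn Ω) : Ω → ℂ) =ᶠ[𝓝 (x : Eucl d)]
        fun y => fderiv ℝ (zeroExt (f : Ω → ℂ)) y (basisVec j) :=
      zeroExt_eventuallyEq (partialDeriv_apply j f) x
    have hd : DifferentiableAt ℝ (fderiv ℝ (zeroExt (f : Ω → ℂ))) (x : Eucl d) :=
      ((contDiffAt f x).fderiv_right (m := 1)
        (by rw [one_add_one_eq_two]; exact ENat.LEInfty.out)).differentiableAt (by simp)
    rw [partialDeriv_apply, h.fderiv_eq, fderiv_clm_apply hd (differentiableAt_const _)]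
    simp
  ext x
  rw [key, key]
  exact ((contDiffAt f x).isSymmSndFDerivAt
    (by simp only [minSmoothness_of_isRCLikeNormedField]; exact ENat.LEInfty.out)).eq _ _

/-- The derivative `∂^α` on `ℰ(Ω)`. -/
def deriv (α : Fin d → ℕ) (f : SmoothFn Ω) : SmoothFn Ω :=
  multiIter (fun i => partialDeriv i) α f

theorem deriv_zero (f : SmoothFn Ω) : deriv 0 f = f := multiIter_zero _ f

theorem deriv_add_single (α : Fin d → ℕ) (j : Fin d) (f : SmoothFn Ω) :
    deriv (bumpIdx α j) f = deriv α (partialDeriv j f) :=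
  multiIter_add_single _ (fun i j a => partialDeriv_comm i j a) α j f

theorem deriv_induction {P : (Fin d → ℕ) → Prop} (h0 : P 0)
    (h : ∀ α j, P α → P (bumpIdx α j)) (α : Fin d → ℕ) : P α := by
  induction hn : absIdx α generalizing α with
  | zero =>
    have : α = 0 := by
      funext i
      exact (Finset.sum_eq_zero_iff.1 hn) i (Finset.mem_univ i)
    rwa [this]
  | succ n ih =>
    obtain ⟨j, hj⟩ : ∃ j, α j ≠ 0 := by
      by_contra! hc
      simp [absIdx, hc] at hn
    have hα : α = bumpIdx (fun i => α i - if i = j then 1 else 0) j := by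
      funext i
      by_cases hi : i = j
      · subst hi; simp [bumpIdx]; omega
      · simp [bumpIdx, hi]
    rw [hα]
    apply h
    apply ih
    rw [hα] at hn
    simp only [absIdx, bumpIdx, Finset.sum_add_distrib] at hn
    simpa [absIdx] using hn

theorem deriv_add (α : Fin d → ℕ) (f g : SmoothFn Ω) :
    deriv α (f + g) = deriv α f + deriv α g := by
  revert f g
  refine deriv_induction (P := fun α => ∀ f g : SmoothFn Ω, deriv α (f + g) = deriv α f + deriv α g)
    (by simp [deriv_zero]) (fun α j ih f g => ?_) α
  simp only [deriv_add_single, map_add, ih]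

theorem deriv_smul (α : Fin d → ℕ) (c : ℂ) (f : SmoothFn Ω) :
    deriv α (c • f) = c • deriv α f := by
  revert f
  refine deriv_induction (P := fun α => ∀ f : SmoothFn Ω, deriv α (c • f) = c • deriv α f)
    (by simp [deriv_zero]) (fun α j ih f => ?_) α
  rw [deriv_add_single, deriv_add_single, Derivation.map_smul, ih]

/-- Restriction of smooth functions to a smaller open set. -/
def restrict (h : O ≤ Ω) : SmoothFn Ω →ₐ[ℂ] SmoothFn O where
  toFun f := ⟨fun x => (f : Ω → ℂ) ⟨x, h x.2⟩,
    ((f.2 : ContDiffOn ℝ ∞ _ _).mono h).congr fun x hx => by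
      rw [zeroExt_of_mem _ hx, zeroExt_of_mem _ (h hx)]⟩
  map_one' := rfl
  map_mul' _ _ := rfl
  map_zero' := rfl
  map_add' _ _ := rfl
  commutes' _ := rfl

theorem partialDeriv_restrict (h : O ≤ Ω) (i : Fin d) (f : SmoothFn Ω) :
    partialDeriv i (restrict h f) = restrict h (partialDeriv i f) := by
  ext x
  have he : zeroExt ((restrict h f : SmoothFn O) : O → ℂ) =ᶠ[𝓝 (x : Eucl d)]
      zeroExt (f : Ω → ℂ) :=
    zeroExt_eventuallyEq (fun y => (zeroExt_of_mem _ (h y.2)).symm) x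
  rw [partialDeriv_apply, he.fderiv_eq]
  rfl

theorem deriv_restrict (h : O ≤ Ω) (α : Fin d → ℕ) (f : SmoothFn Ω) :
    deriv α (restrict h f) = restrict h (deriv α f) := by
  revert f
  refine deriv_induction
    (P := fun α => ∀ f : SmoothFn Ω, deriv α (restrict h f) = restrict h (deriv α f))
    (by simp [deriv_zero]) (fun α j ih f => ?_) α
  simp only [deriv_add_single, partialDeriv_restrict, ih]

theorem continuousOn (f : SmoothFn Ω) : ContinuousOn (zeroExt (f : Ω → ℂ)) Ω :=
  (f.2 : ContDiffOn ℝ ∞ _ _).continuousOn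

theorem exists_bound (f : SmoothFn Ω) {K : Set (Eucl d)} (hK : IsCompact K)
    (hKΩ : K ⊆ (Ω : Set (Eucl d))) : ∃ C : ℝ, ∀ x : Ω, (x : Eucl d) ∈ K → ‖(f : Ω → ℂ) x‖ ≤ C := by
  obtain ⟨C, hC⟩ := hK.exists_bound_of_continuousOn ((continuousOn f).mono hKΩ)
  exact ⟨C, fun x hx => by simpa [zeroExt_apply] using hC x hx⟩

end SmoothFn

/-! ### Asymptotic functions -/

section Functions

variable [NeZero d] (U : DirectingUltrafilter d) {Ω O : Opens (Eucl d)}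

/-- For some `m`, `sup_K |f_φ| ≤ R_φ^(-m)` almost everywhere. -/
def ModerateOn (K : Set (Eucl d)) (f : TestFn d → SmoothFn Ω) : Prop :=
  ∃ m : ℕ, U.AE (fun φ => ∀ x : Ω, (x : Eucl d) ∈ K →
    ‖(f φ : Ω → ℂ) x‖ ≤ (suppRadius φ)⁻¹ ^ m)

/-- For every `p`, `sup_K |f_φ| ≤ R_φ^p` almost everywhere. -/
def NegligibleOn (K : Set (Eucl d)) (f : TestFn d → SmoothFn Ω) : Prop :=
  ∀ p : ℕ, U.AE (fun φ => ∀ x : Ω, (x : Eucl d) ∈ K →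
    ‖(f φ : Ω → ℂ) x‖ ≤ suppRadius φ ^ p)

variable {U}

theorem ModerateOn.add {K : Set (Eucl d)} {f g : TestFn d → SmoothFn Ω}
    (hf : ModerateOn U K f) (hg : ModerateOn U K g) : ModerateOn U K (fun φ => f φ + g φ) := by
  obtain ⟨m, hm⟩ := hf
  obtain ⟨k, hk⟩ := hg
  refine ⟨m + k + 1, ((hm.and hk).and ((U.ae_radius_mul_le 1).and
    (U.ae_mul_inv_pow_le 2 (m + k)))).mono fun φ h x hx => ?_⟩
  obtain ⟨⟨h1, h2⟩, h3, h4⟩ := h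
  have hR := one_le_inv_suppRadius φ h3
  calc ‖(f φ : Ω → ℂ) x + (g φ : Ω → ℂ) x‖ ≤ (suppRadius φ)⁻¹ ^ m + (suppRadius φ)⁻¹ ^ k :=
        (norm_add_le _ _).trans (add_le_add (h1 x hx) (h2 x hx))
    _ ≤ (suppRadius φ)⁻¹ ^ (m + k) + (suppRadius φ)⁻¹ ^ (m + k) := by
        gcongr <;> first | exact hR | omega
    _ ≤ _ := by linarith

theorem ModerateOn.mul {K : Set (Eucl d)} {f g : TestFn d → SmoothFn Ω}
    (hf : ModerateOn U K f) (hg : ModerateOn U K g) : ModerateOn U K (fun φ => f φ * g φ) := by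
  obtain ⟨m, hm⟩ := hf
  obtain ⟨k, hk⟩ := hg
  refine ⟨m + k, (hm.and hk).mono fun φ h x hx => ?_⟩
  have hR := suppRadius_pos φ
  rw [Subalgebra.coe_mul, Pi.mul_apply, norm_mul, pow_add]
  gcongr
  exacts [h.1 x hx, h.2 x hx]

theorem ModerateOn.const {K : Set (Eucl d)} (hK : IsCompact K) (hKΩ : K ⊆ (Ω : Set (Eucl d)))
    (f : SmoothFn Ω) : ModerateOn U K (fun _ => f) := by
  obtain ⟨C, hC⟩ := SmoothFn.exists_bound f hK hKΩ
  refine ⟨1, (U.ae_mul_inv_pow_le C 0).mono fun φ h x hx => (hC x hx).trans ?_⟩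
  simpa using h

theorem NegligibleOn.add {K : Set (Eucl d)} {f g : TestFn d → SmoothFn Ω}
    (hf : NegligibleOn U K f) (hg : NegligibleOn U K g) :
    NegligibleOn U K (fun φ => f φ + g φ) := by
  intro p
  refine (((hf (p + 1)).and (hg (p + 1))).and (U.ae_mul_pow_lt 2 p)).mono fun φ h x hx => ?_
  obtain ⟨⟨h1, h2⟩, h3⟩ := h
  have := norm_add_le ((f φ : Ω → ℂ) x) ((g φ : Ω → ℂ) x)
  have := h1 x hx
  have := h2 x hx
  simp only [Subalgebra.coe_add, Pi.add_apply]
  linarith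

theorem ModerateOn.mul_negligibleOn {K : Set (Eucl d)} {f g : TestFn d → SmoothFn Ω}
    (hf : ModerateOn U K f) (hg : NegligibleOn U K g) :
    NegligibleOn U K (fun φ => f φ * g φ) := by
  intro p
  obtain ⟨m, hm⟩ := hf
  refine (hm.and (hg (p + m))).mono fun φ h x hx => ?_
  have hR := suppRadius_pos φ
  rw [Subalgebra.coe_mul, Pi.mul_apply, norm_mul]
  calc _ ≤ (suppRadius φ)⁻¹ ^ m * suppRadius φ ^ (p + m) := by
        gcongr
        exacts [h.1 x hx, h.2 x hx]
    _ = _ := by rw [pow_add, mul_comm, mul_assoc, ← mul_pow, mul_inv_cancel₀ hR.ne', one_pow,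
            mul_one]

theorem ModerateOn.deriv_mul {K : Set (Eucl d)} {f g : TestFn d → SmoothFn Ω}
    (hf : ∀ α, ModerateOn U K (fun φ => SmoothFn.deriv α (f φ)))
    (hg : ∀ α, ModerateOn U K (fun φ => SmoothFn.deriv α (g φ))) (α : Fin d → ℕ) :
    ModerateOn U K (fun φ => SmoothFn.deriv α (f φ * g φ)) := by
  revert f g
  refine SmoothFn.deriv_induction (P := fun α => ∀ {f g : TestFn d → SmoothFn Ω},
    (∀ α, ModerateOn U K (fun φ => SmoothFn.deriv α (f φ))) →
    (∀ α, ModerateOn U K (fun φ => SmoothFn.deriv α (g φ))) →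
    ModerateOn U K (fun φ => SmoothFn.deriv α (f φ * g φ))) ?_ ?_ α
  · intro f g hf hg
    simpa only [SmoothFn.deriv_zero] using (hf 0).mul (hg 0)
  · intro α j ih f g hf hg
    simp only [SmoothFn.deriv_add_single, Derivation.leibniz, SmoothFn.deriv_add, smul_eq_mul]
    refine (ih hf fun β => ?_).add (ih hg fun β => ?_)
    · simpa only [SmoothFn.deriv_add_single] using hg (bumpIdx β j)
    · simpa only [SmoothFn.deriv_add_single] using hf (bumpIdx β j)

theorem NegligibleOn.deriv_mul {K : Set (Eucl d)} {f g : TestFn d → SmoothFn Ω}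
    (hf : ∀ α, ModerateOn U K (fun φ => SmoothFn.deriv α (f φ)))
    (hg : ∀ α, NegligibleOn U K (fun φ => SmoothFn.deriv α (g φ))) (α : Fin d → ℕ) :
    NegligibleOn U K (fun φ => SmoothFn.deriv α (f φ * g φ)) := by
  revert f g
  refine SmoothFn.deriv_induction (P := fun α => ∀ {f g : TestFn d → SmoothFn Ω},
    (∀ α, ModerateOn U K (fun φ => SmoothFn.deriv α (f φ))) →
    (∀ α, NegligibleOn U K (fun φ => SmoothFn.deriv α (g φ))) →
    NegligibleOn U K (fun φ => SmoothFn.deriv α (f φ * g φ))) ?_ ?_ α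
  · intro f g hf hg
    simpa only [SmoothFn.deriv_zero] using (hf 0).mul_negligibleOn (hg 0)
  · intro α j ih f g hf hg
    have hrw : ∀ φ, SmoothFn.deriv (bumpIdx α j) (f φ * g φ) =
        SmoothFn.deriv α (f φ * SmoothFn.partialDeriv j (g φ)) +
        SmoothFn.deriv α (SmoothFn.partialDeriv j (f φ) * g φ) := by
      intro φ
      simp only [SmoothFn.deriv_add_single, Derivation.leibniz, SmoothFn.deriv_add, smul_eq_mul,
        mul_comm]
    simp only [hrw]
    refine (ih hf fun β => ?_).add (ih (fun β => ?_) hg)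
    · simpa only [SmoothFn.deriv_add_single] using hg (bumpIdx β j)
    · simpa only [SmoothFn.deriv_add_single] using hf (bumpIdx β j)

variable (U)

/-- The moderate nets in `ℰ(Ω)`: for every compact `K ⊆ Ω` and every multi-index `α` there is
`m` such that `sup_K |∂^α f_φ| ≤ R_φ^(-m)` almost everywhere. -/
def moderateFun (Ω : Opens (Eucl d)) : Subalgebra ℂ (TestFn d → SmoothFn Ω) where
  carrier := {f | ∀ K : Set (Eucl d), IsCompact K → K ⊆ (Ω : Set (Eucl d)) → ∀ α : Fin d → ℕ,
    ModerateOn U K (fun φ => SmoothFn.deriv α (f φ))}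
  mul_mem' := fun hf hg K hK hKΩ => ModerateOn.deriv_mul (hf K hK hKΩ) (hg K hK hKΩ)
  add_mem' := fun hf hg K hK hKΩ α => by
    simpa only [Pi.add_apply, SmoothFn.deriv_add] using (hf K hK hKΩ α).add (hg K hK hKΩ α)
  algebraMap_mem' := fun c K hK hKΩ α => 
    ModerateOn.const hK hKΩ (SmoothFn.deriv α (algebraMap ℂ (SmoothFn Ω) c))

instance (Ω : Opens (Eucl d)) : CommRing (moderateFun U Ω) := (moderateFun U Ω).toCommRing
instance (Ω : Opens (Eucl d)) : Algebra ℂ (moderateFun U Ω) := (moderateFun U Ω).algebra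

/-- The negligible nets in `ℰ(Ω)`: for every compact `K ⊆ Ω`, every multi-index `α` and every
`p`, one has `sup_K |∂^α f_φ| ≤ R_φ^p` almost everywhere. -/
def negligibleFun (Ω : Opens (Eucl d)) : Ideal (moderateFun U Ω) where
  carrier := {f | ∀ K : Set (Eucl d), IsCompact K → K ⊆ (Ω : Set (Eucl d)) → ∀ α : Fin d → ℕ,
    NegligibleOn U K (fun φ => SmoothFn.deriv α ((f : TestFn d → SmoothFn Ω) φ))}
  zero_mem' := by
    intro K hK hKΩ α p
    refine U.ae_of_forall fun φ x hx => ?_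
    have h0 : SmoothFn.deriv α (0 : SmoothFn Ω) = 0 := by
      have := SmoothFn.deriv_smul α 0 (0 : SmoothFn Ω)
      simpa using this
    simp only [ZeroMemClass.coe_zero, Pi.zero_apply, h0, norm_zero]
    exact pow_nonneg (suppRadius_pos φ).le p
  add_mem' := fun hf hg K hK hKΩ α => by
    simpa only [Subalgebra.coe_add, Pi.add_apply, SmoothFn.deriv_add] using
      (hf K hK hKΩ α).add (hg K hK hKΩ α)
  smul_mem' := fun f _ hg K hK hKΩ => NegligibleOn.deriv_mul (f.2 K hK hKΩ) (hg K hK hKΩ)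

/-- The algebra of asymptotic functions on `Ω`: moderate nets modulo negligible nets. -/
def AsympFun (Ω : Opens (Eucl d)) : Type := moderateFun U Ω ⧸ negligibleFun U Ω

instance (Ω : Opens (Eucl d)) : CommRing (AsympFun U Ω) :=
  inferInstanceAs (CommRing (moderateFun U Ω ⧸ negligibleFun U Ω))
instance (Ω : Opens (Eucl d)) : Algebra ℂ (AsympFun U Ω) :=
  inferInstanceAs (Algebra ℂ (moderateFun U Ω ⧸ negligibleFun U Ω))

variable {U}

/-- The class of a moderate net. -/
def AsympFun.mk : moderateFun U Ω →ₐ[ℂ] AsympFun U Ω := Ideal.Quotient.mkₐ ℂ (negligibleFun U Ω)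

/-- The class of a moderate net of complex numbers. -/
def AsympNum.mk : moderateNum U →ₐ[ℂ] AsympNum U := Ideal.Quotient.mkₐ ℂ (negligibleNum U)

theorem AsympFun.mk_eq_zero {f : moderateFun U Ω} :
    (AsympFun.mk f : AsympFun U Ω) = 0 ↔ f ∈ negligibleFun U Ω :=
  Ideal.Quotient.eq_zero_iff_mem

theorem AsympNum.mk_eq_zero {A : moderateNum U} :
    (AsympNum.mk A : AsympNum U) = 0 ↔ A ∈ negligibleNum U :=
  Ideal.Quotient.eq_zero_iff_mem

theorem AsympNum.algebraMap_eq (c : ℂ) :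
    algebraMap ℂ (AsympNum U) c = AsympNum.mk (algebraMap ℂ (moderateNum U) c) :=
  ((AsympNum.mk (U := U)).commutes c).symm

theorem AsympFun.mk_surjective (a : AsympFun U Ω) :
    ∃ f : moderateFun U Ω, AsympFun.mk f = a :=
  Ideal.Quotient.mk_surjective a

/-- Partial derivatives of moderate nets. -/
def netPartial (i : Fin d) : moderateFun U Ω →ₗ[ℂ] moderateFun U Ω where
  toFun f := ⟨fun φ => SmoothFn.partialDeriv i ((f : TestFn d → SmoothFn Ω) φ),
    fun K hK hKΩ α => by
      simpa only [SmoothFn.deriv_add_single] using f.2 K hK hKΩ (bumpIdx α i)⟩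
  map_add' _ _ := Subtype.ext (funext fun _ => map_add (SmoothFn.partialDeriv i) _ _)
  map_smul' _ _ := Subtype.ext (funext fun _ => (SmoothFn.partialDeriv i).map_smul _ _)

theorem netPartial_mul (i : Fin d) (f g : moderateFun U Ω) :
    netPartial i (f * g) = f * netPartial i g + g * netPartial i f :=
  Subtype.ext (funext fun _ => (SmoothFn.partialDeriv i).leibniz _ _)

theorem netPartial_mem (i : Fin d) (f : moderateFun U Ω) (hf : f ∈ negligibleFun U Ω) :
    netPartial i f ∈ negligibleFun U Ω := by
  intro K hK hKΩ α
  have := hf K hK hKΩ (bumpIdx α i)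
  simp only [SmoothFn.deriv_add_single] at this
  exact this

/-- The linear map underlying the partial derivative `∂_i` on asymptotic functions: the class of
`(f_φ)` is sent to the class of `(∂_i f_φ)`. -/
def AsympFun.partialLin (i : Fin d) : AsympFun U Ω →ₗ[ℂ] AsympFun U Ω :=
  descend (AsympFun.mk (U := U) (Ω := Ω)).toLinearMap AsympFun.mk_surjective
    ((AsympFun.mk (U := U) (Ω := Ω)).toLinearMap ∘ₗ netPartial i)
    (fun f hf => AsympFun.mk_eq_zero.2 (netPartial_mem i f (AsympFun.mk_eq_zero.1 hf)))

theorem AsympFun.partialLin_mk (i : Fin d) (f : moderateFun U Ω) :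
    (AsympFun.partialLin i (AsympFun.mk f) : AsympFun U Ω) = AsympFun.mk (netPartial i f) :=
  descend_apply (AsympFun.mk (U := U) (Ω := Ω)).toLinearMap AsympFun.mk_surjective _ _ f

/-- The partial derivative `∂_i` on asymptotic functions, as a derivation. -/
def AsympFun.partialDeriv (i : Fin d) : Derivation ℂ (AsympFun U Ω) (AsympFun U Ω) :=
  Derivation.mk' (AsympFun.partialLin i) (by
    intro a b
    obtain ⟨f, rfl⟩ := AsympFun.mk_surjective a
    obtain ⟨g, rfl⟩ := AsympFun.mk_surjective b
    rw [← map_mul, AsympFun.partialLin_mk, netPartial_mul, map_add,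
      map_mul, map_mul, AsympFun.partialLin_mk, AsympFun.partialLin_mk,
      smul_eq_mul, smul_eq_mul])

theorem AsympFun.partialDeriv_mk (i : Fin d) (f : moderateFun U Ω) :
    (AsympFun.partialDeriv i (AsympFun.mk f) : AsympFun U Ω) = AsympFun.mk (netPartial i f) :=
  AsympFun.partialLin_mk i f

/-- The derivative `∂^α` on asymptotic functions. -/
def AsympFun.deriv (α : Fin d → ℕ) (a : AsympFun U Ω) : AsympFun U Ω :=
  multiIter (fun i => AsympFun.partialDeriv i) α a

/-- Restriction of moderate nets to a smaller open set. -/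
def netRestrict (h : O ≤ Ω) : moderateFun U Ω →ₐ[ℂ] moderateFun U O where
  toFun f := ⟨fun φ => SmoothFn.restrict h ((f : TestFn d → SmoothFn Ω) φ),
    fun K hK hKO α => by
      obtain ⟨m, hm⟩ := f.2 K hK (hKO.trans h) α
      refine ⟨m, hm.mono fun φ hφ x hx => ?_⟩
      change ‖((SmoothFn.deriv α (SmoothFn.restrict h _) : SmoothFn O) : O → ℂ) x‖ ≤ _
      rw [SmoothFn.deriv_restrict]
      exact hφ ⟨x, h x.2⟩ hx⟩
  map_one' := rfl
  map_mul' _ _ := rfl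
  map_zero' := rfl
  map_add' _ _ := rfl
  commutes' _ := rfl

theorem netRestrict_mem (h : O ≤ Ω) (f : moderateFun U Ω) (hf : f ∈ negligibleFun U Ω) :
    netRestrict h f ∈ negligibleFun U O := by
  intro K hK hKO α p
  refine (hf K hK (hKO.trans h) α p).mono fun φ hφ x hx => ?_
  change ‖((SmoothFn.deriv α (SmoothFn.restrict h _) : SmoothFn O) : O → ℂ) x‖ ≤ _
  rw [SmoothFn.deriv_restrict]
  exact hφ ⟨x, h x.2⟩ hx

/-- Restriction of asymptotic functions to a smaller open set: the class of `(f_φ)` is sent to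
the class of `(f_φ|O)`. -/
def AsympFun.restrict (h : O ≤ Ω) : AsympFun U Ω →ₐ[ℂ] AsympFun U O :=
  Ideal.quotientMapₐ (negligibleFun U O) (netRestrict h) (fun f hf => netRestrict_mem h f hf)

theorem AsympFun.restrict_mk (h : O ≤ Ω) (f : moderateFun U Ω) :
    (AsympFun.restrict h (AsympFun.mk f) : AsympFun U O) = AsympFun.mk (netRestrict h f) := rfl

/-- The constant nets, as moderate nets. -/
def constNet (U : DirectingUltrafilter d) (Ω : Opens (Eucl d)) :
    SmoothFn Ω →ₐ[ℂ] moderateFun U Ω where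
  toFun f := ⟨fun _ => f, fun _ hK hKΩ α => ModerateOn.const hK hKΩ (SmoothFn.deriv α f)⟩
  map_one' := rfl
  map_mul' _ _ := rfl
  map_zero' := rfl
  map_add' _ _ := rfl
  commutes' _ := rfl

/-- The standard embedding `σ_Ω : ℰ(Ω) → AsympFun U Ω`, given by the constant nets. -/
def stdEmb (U : DirectingUltrafilter d) (Ω : Opens (Eucl d)) : SmoothFn Ω →ₐ[ℂ] AsympFun U Ω :=
  AsympFun.mk.comp (constNet U Ω)

/-! ### The pairing of asymptotic functions with test functions -/

theorem zeroExt_mul_integrable (f : SmoothFn Ω) (τ : 𝓓(Ω, ℂ)) :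
    Integrable (fun x => zeroExt (f : Ω → ℂ) x * τ x) := by
  have hsub : tsupport (fun x => zeroExt (f : Ω → ℂ) x * τ x) ⊆ tsupport τ :=
    tsupport_mul_subset_right
  refine Continuous.integrable_of_hasCompactSupport ?_ (τ.hasCompactSupport.mul_left)
  refine continuous_of_tsupport fun x hx => ?_
  have hxΩ : x ∈ Ω := τ.tsupport_subset (hsub hx)
  exact (SmoothFn.contDiffAt f ⟨x, hxΩ⟩).continuousAt.mul τ.contDiff.continuous.continuousAt

/-- The pairing `(f | τ) = ∫_Ω f(x) τ(x) dx` of a smooth function and a test function. -/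
def smoothPairing (f : SmoothFn Ω) (τ : 𝓓(Ω, ℂ)) : ℂ :=
  ∫ x in (Ω : Set (Eucl d)), zeroExt (f : Ω → ℂ) x * τ x

theorem smoothPairing_add (f g : SmoothFn Ω) (τ : 𝓓(Ω, ℂ)) :
    smoothPairing (f + g) τ = smoothPairing f τ + smoothPairing g τ := by
  rw [smoothPairing, smoothPairing, smoothPairing,
    ← integral_add (zeroExt_mul_integrable f τ).integrableOn
      (zeroExt_mul_integrable g τ).integrableOn]
  refine setIntegral_congr_fun Ω.isOpen.measurableSet fun x hx => ?_
  simp [zeroExt_of_mem _ hx, add_mul]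

theorem smoothPairing_smul (c : ℂ) (f : SmoothFn Ω) (τ : 𝓓(Ω, ℂ)) :
    smoothPairing (c • f) τ = c * smoothPairing f τ := by
  rw [smoothPairing, smoothPairing, ← integral_const_mul]
  refine setIntegral_congr_fun Ω.isOpen.measurableSet fun x hx => ?_
  simp [zeroExt_of_mem _ hx, mul_assoc]

theorem norm_smoothPairing_le (f : SmoothFn Ω) (τ : 𝓓(Ω, ℂ)) (B : ℝ) (hB : 0 ≤ B)
    (h : ∀ x : Ω, (x : Eucl d) ∈ tsupport τ → ‖(f : Ω → ℂ) x‖ ≤ B) :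
    ‖smoothPairing f τ‖ ≤ (∫ x in (Ω : Set (Eucl d)), ‖τ x‖) * B := by
  rw [mul_comm, ← integral_const_mul]
  refine norm_integral_le_of_norm_le (Integrable.const_mul ?_ _) (Eventually.of_forall fun x => ?_)
  · exact (τ.contDiff.continuous.integrable_of_hasCompactSupport
      τ.hasCompactSupport).norm.integrableOn
  · rw [norm_mul]
    by_cases hx : x ∈ tsupport τ
    · have := h ⟨x, τ.tsupport_subset hx⟩ hx
      rw [zeroExt_of_mem _ (τ.tsupport_subset hx)]
      gcongr
    · simp [image_eq_zero_of_notMem_tsupport hx]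

/-- The pairing of a moderate net with a test function. -/
def netPairing (U : DirectingUltrafilter d) {Ω : Opens (Eucl d)} (τ : 𝓓(Ω, ℂ)) :
    moderateFun U Ω →ₗ[ℂ] moderateNum U where
  toFun f := ⟨fun φ => smoothPairing ((f : TestFn d → SmoothFn Ω) φ) τ, by
    obtain ⟨m, hm⟩ := f.2 _ τ.hasCompactSupport τ.tsupport_subset 0
    refine ⟨m + 1, (hm.and (U.ae_mul_inv_pow_le
      (∫ x in (Ω : Set (Eucl d)), ‖τ x‖) m)).mono fun φ h => ?_⟩
    have hR := suppRadius_pos φ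
    refine (norm_smoothPairing_le _ τ _ (by positivity) fun x hx => ?_).trans h.2
    simpa only [SmoothFn.deriv_zero] using h.1 x hx⟩
  map_add' _ _ := Subtype.ext (funext fun _ => smoothPairing_add _ _ τ)
  map_smul' _ _ := Subtype.ext (funext fun _ => smoothPairing_smul _ _ τ)

theorem netPairing_mem (τ : 𝓓(Ω, ℂ)) (f : moderateFun U Ω) (hf : f ∈ negligibleFun U Ω) :
    netPairing U τ f ∈ negligibleNum U := by
  intro p
  refine ((hf _ τ.hasCompactSupport τ.tsupport_subset 0 (p + 1)).and (U.ae_mul_pow_lt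
    (∫ x in (Ω : Set (Eucl d)), ‖τ x‖) p)).mono fun φ h => ?_
  have hR := suppRadius_pos φ
  refine (norm_smoothPairing_le _ τ _ (by positivity) fun x hx => ?_).trans_lt h.2
  simpa only [SmoothFn.deriv_zero] using h.1 x hx

/-- The pairing of asymptotic functions with test functions; the class of `(f_φ)` is paired with
`τ` to the class of `(∫_Ω f_φ(x) τ(x) dx)`. -/
def AsympFun.pairing (τ : 𝓓(Ω, ℂ)) : AsympFun U Ω →ₗ[ℂ] AsympNum U :=
  descend (AsympFun.mk (U := U) (Ω := Ω)).toLinearMap AsympFun.mk_surjective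
    ((AsympNum.mk (U := U)).toLinearMap ∘ₗ netPairing U τ)
    (fun f hf => AsympNum.mk_eq_zero.2 (netPairing_mem τ f (AsympFun.mk_eq_zero.1 hf)))

theorem AsympFun.pairing_mk (τ : 𝓓(Ω, ℂ)) (f : moderateFun U Ω) :
    AsympFun.pairing τ (AsympFun.mk f : AsympFun U Ω) = AsympNum.mk (netPairing U τ f) :=
  descend_apply (AsympFun.mk (U := U) (Ω := Ω)).toLinearMap AsympFun.mk_surjective _ _ f

end Functions

/-! ### Distributions and locally integrable functions -/

section Distributions

variable {Ω O : Opens (Eucl d)}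

/-- `𝒟'(Ω)`, the continuous `ℂ`-linear functionals on `𝒟(Ω)`. -/
abbrev Distr (Ω : Opens (Eucl d)) : Type := 𝓓(Ω, ℂ) →L[ℂ] ℂ

/-- The partial derivative `∂_i` on `𝒟'(Ω)`: `(∂_i T | τ) = -(T | ∂_i τ)`. -/
def Distr.partialDeriv (i : Fin d) (T : Distr Ω) : Distr Ω :=
  -(T.comp (testPartial Ω i))

/-- The derivative `∂^α` on `𝒟'(Ω)`. -/
def Distr.deriv (α : Fin d → ℕ) (T : Distr Ω) : Distr Ω :=
  multiIter (fun i => Distr.partialDeriv i) α T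

/-- Restriction of distributions to a smaller open set `O ⊆ Ω`: composition with the inclusion
`𝒟(O) → 𝒟(Ω)`. -/
def Distr.restrict (_h : O ≤ Ω) (T : Distr Ω) : Distr O :=
  T.comp (TestFunction.monoCLM ℂ)

/-- The space of locally (Lebesgue) integrable functions on `Ω`,
two functions being identified if they agree almost everywhere on `Ω`. -/
def LocInt (Ω : Opens (Eucl d)) :
    Submodule ℂ (Eucl d →ₘ[volume.restrict (Ω : Set (Eucl d))] ℂ) where
  carrier := {f | LocallyIntegrableOn f (Ω : Set (Eucl d)) volume}
  zero_mem' := (locallyIntegrableOn_zero).congr AEEqFun.coeFn_zero.symm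
  add_mem' := fun {f g} hf hg => (LocallyIntegrableOn.add hf hg).congr (AEEqFun.coeFn_add f g).symm
  smul_mem' := fun c f hf => (LocallyIntegrableOn.smul hf c).congr (AEEqFun.coeFn_smul c f).symm

theorem LocInt.locallyIntegrableOn (f : LocInt Ω) :
    LocallyIntegrableOn (f : Eucl d →ₘ[volume.restrict (Ω : Set (Eucl d))] ℂ) (Ω : Set (Eucl d))
      volume := f.2

/-- The class of a function which is locally integrable on `Ω`. -/
def LocInt.mk (f : Eucl d → ℂ) (hf : LocallyIntegrableOn f (Ω : Set (Eucl d)) volume) :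
    LocInt Ω :=
  ⟨AEEqFun.mk f hf.aestronglyMeasurable, hf.congr (AEEqFun.coeFn_mk f _).symm⟩

/-- Restriction of locally integrable functions to a smaller open set. -/
def LocInt.restrict (h : O ≤ Ω) (f : LocInt Ω) : LocInt O :=
  LocInt.mk (f : Eucl d →ₘ[volume.restrict (Ω : Set (Eucl d))] ℂ)
    ((LocInt.locallyIntegrableOn f).mono_set h)

/-- The inclusion `ℰ(Ω) ⊆ L_loc(Ω)`. -/
def SmoothFn.toLocInt (f : SmoothFn Ω) : LocInt Ω :=
  LocInt.mk (zeroExt (f : Ω → ℂ))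
    ((SmoothFn.continuousOn f).locallyIntegrableOn Ω.isOpen.measurableSet)

/-- The Schwartz embedding `L_Ω : L_loc(Ω) → 𝒟'(Ω)`, with `(L_Ω f | τ) = ∫_Ω f(x) τ(x) dx`. -/
def schwartzEmb (f : LocInt Ω) : Distr Ω :=
  TestFunction.integralAgainstBilinCLM (ContinuousLinearMap.mul ℂ ℂ) volume
    (f : Eucl d →ₘ[volume.restrict (Ω : Set (Eucl d))] ℂ)

theorem schwartzEmb_apply (f : LocInt Ω) (τ : 𝓓(Ω, ℂ)) :
    schwartzEmb f τ = ∫ x in (Ω : Set (Eucl d)),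
      (f : Eucl d →ₘ[volume.restrict (Ω : Set (Eucl d))] ℂ) x * τ x := by
  rw [schwartzEmb, TestFunction.integralAgainstBilinCLM_eq_integral
    (LocInt.locallyIntegrableOn f), setIntegral_eq_integral_of_forall_compl_eq_zero]
  · simp only [ContinuousLinearMap.mul_apply', mul_comm]
  · intro x hx
    rw [image_eq_zero_of_notMem_tsupport (fun h => hx (τ.tsupport_subset h)), mul_zero]

end Distributions

/-! ### The regularization of a distribution -/

section Regularization

variable [NeZero d] {Ω : Opens (Eucl d)}

/-- The set of all `x ∈ Ω` with `d(x, ∂Ω) > 2 R_φ` and `‖x‖ < 1 / R_φ`; the distance to an empty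
boundary is `∞`. -/
def cutoffDomain (Ω : Opens (Eucl d)) (φ : TestFn d) : Set (Eucl d) :=
  {x | x ∈ Ω ∧ ENNReal.ofReal (2 * suppRadius φ) < Metric.infEDist x (frontier (Ω : Set (Eucl d))) ∧
    ‖x‖ < 1 / suppRadius φ}

/-- The cut-off function `C_{Ω,φ} = χ ⋆ φ`, where `χ` is the characteristic function of
`cutoffDomain Ω φ`. -/
def cutoff (Ω : Opens (Eucl d)) (φ : TestFn d) (x : Eucl d) : ℂ :=
  ∫ t in cutoffDomain Ω φ, φ (x - t)

theorem measurableSet_cutoffDomain (Ω : Opens (Eucl d)) (φ : TestFn d) :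
    MeasurableSet (cutoffDomain Ω φ) := by
  refine Ω.isOpen.measurableSet.inter (MeasurableSet.inter ?_ ?_)
  · exact measurableSet_lt measurable_const measurable_infEDist
  · exact measurableSet_lt measurable_norm measurable_const

theorem contDiff_cutoff (Ω : Opens (Eucl d)) (φ : TestFn d) : ContDiff ℝ ∞ (cutoff Ω φ) := by
  have hm := measurableSet_cutoffDomain Ω φ
  have h1 : LocallyIntegrable ((cutoffDomain Ω φ).indicator (fun _ => (1 : ℝ))) volume :=
    (locallyIntegrable_const 1).indicator hm
  have h2 := φ.hasCompactSupport.contDiff_convolution_right (n := ⊤)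
    (ContinuousLinearMap.lsmul ℝ ℝ) h1 φ.contDiff
  convert h2 using 1
  funext x
  rw [cutoff, convolution_def, ← integral_indicator hm]
  congr 1
  funext t
  by_cases ht : t ∈ cutoffDomain Ω φ <;> simp [ht]

theorem tsupport_cutoff_subset (Ω : Opens (Eucl d)) (φ : TestFn d) :
    tsupport (cutoff Ω φ) ⊆ (Ω : Set (Eucl d)) := by
  have hR := suppRadius_pos φ
  have hclosed : IsClosed {x : Eucl d | ENNReal.ofReal (suppRadius φ) ≤
      Metric.infEDist x (Ω : Set (Eucl d))ᶜ} :=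
    isClosed_le continuous_const Metric.continuous_infEDist
  have hsub : {x : Eucl d | ENNReal.ofReal (suppRadius φ) ≤
      Metric.infEDist x (Ω : Set (Eucl d))ᶜ} ⊆ (Ω : Set (Eucl d)) := by
    intro x hx
    by_contra hxΩ
    have h0 : Metric.infEDist x (Ω : Set (Eucl d))ᶜ = 0 := Metric.infEDist_zero_of_mem hxΩ
    rw [Set.mem_ofPred_eq, h0] at hx
    simp only [nonpos_iff_eq_zero, ENNReal.ofReal_eq_zero] at hx
    linarith
  refine (closure_minimal ?_ hclosed).trans hsub
  intro x hx
  obtain ⟨s, hs, hxs⟩ : ∃ s ∈ cutoffDomain Ω φ, φ (x - s) ≠ 0 := by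
    by_contra! hc
    exact hx (setIntegral_eq_zero_of_forall_eq_zero hc)
  have hdist : dist x s ≤ suppRadius φ := by
    rw [dist_eq_norm]
    exact norm_le_suppRadius φ hxs
  refine Metric.le_infEDist.2 fun y hy => ?_
  by_contra! hlt
  have hxy : dist x y < suppRadius φ := by
    rw [edist_dist] at hlt
    exact (ENNReal.ofReal_lt_ofReal_iff hR).1 hlt
  -- the segment from `s` to `y` meets the boundary
  have hsy : dist s y < 2 * suppRadius φ := by
    have := dist_triangle_left s y x
    linarith
  have hball : IsPreconnected (Metric.ball s (2 * suppRadius φ)) :=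
    (convex_ball s _).isPreconnected
  have hsb : s ∈ Metric.ball s (2 * suppRadius φ) := Metric.mem_ball_self (by linarith)
  have hyb : y ∈ Metric.ball s (2 * suppRadius φ) := by
    rw [Metric.mem_ball, dist_comm]; exact hsy
  obtain ⟨z, hz, hzf⟩ : ∃ z ∈ Metric.ball s (2 * suppRadius φ),
      z ∈ frontier (Ω : Set (Eucl d)) := by
    by_contra! hc
    have hycl : y ∉ closure (Ω : Set (Eucl d)) := fun hcl =>
      hc y hyb (by rw [Ω.isOpen.frontier_eq]; exact ⟨hcl, hy⟩)
    obtain ⟨z, -, hz1, hz2⟩ := hball Ω (closure (Ω : Set (Eucl d)))ᶜ Ω.isOpen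
      isClosed_closure.isOpen_compl (fun z hz => by
        by_cases hzΩ : z ∈ (Ω : Set (Eucl d))
        · exact Or.inl hzΩ
        · exact Or.inr fun hcl => hc z hz (by rw [Ω.isOpen.frontier_eq]; exact ⟨hcl, hzΩ⟩))
      ⟨s, hsb, hs.1⟩ ⟨y, hyb, hycl⟩
    exact hz2 (subset_closure hz1)
  have h3 := hs.2.1.trans_le (Metric.infEDist_le_edist_of_mem hzf)
  rw [edist_dist] at h3
  have h4 := (ENNReal.ofReal_lt_ofReal_iff_of_nonneg (by linarith)).1 h3
  rw [Metric.mem_ball, dist_comm] at hz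
  linarith

/-- The test function `t ↦ C_{Ω,φ}(t) φ(x - t)` on `Ω`. -/
def cutoffTranslate (Ω : Opens (Eucl d)) (φ : TestFn d) (x : Eucl d) : 𝓓(Ω, ℂ) where
  toFun t := cutoff Ω φ t * φ (x - t)
  contDiff' := (contDiff_cutoff Ω φ).mul (φ.contDiff.comp (contDiff_const.sub contDiff_id))
  hasCompactSupport' :=
    (φ.hasCompactSupport.comp_homeomorph (Homeomorph.subLeft x)).mul_left
  tsupport_subset' := tsupport_mul_subset_left.trans (tsupport_cutoff_subset Ω φ)

/-- The `φ`-regularization `T ⊛ φ = (C_{Ω,φ} T) ⋆ φ` of a distribution `T`, that is the function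
`x ↦ (T(t) | C_{Ω,φ}(t) φ(x - t))`. -/
def regularize (T : Distr Ω) (φ : TestFn d) (x : Eucl d) : ℂ :=
  T (cutoffTranslate Ω φ x)

variable (U : DirectingUltrafilter d)

open Classical in
/-- The distributional embedding `E_Ω`: the class of the net `(T ⊛ φ)`. (The value is `0` if
there is no moderate net of smooth functions with the values of `T ⊛ φ`; that this case never
occurs is to be proved.) -/
def distEmb (T : Distr Ω) : AsympFun U Ω :=
  if h : ∃ F : moderateFun U Ω, ∀ (φ : TestFn d) (x : Ω),
      (((F : TestFn d → SmoothFn Ω) φ : SmoothFn Ω) : Ω → ℂ) x = regularize T φ x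
  then AsympFun.mk h.choose else 0

/-- The classical function embedding `E_Ω ∘ L_Ω` of the locally integrable functions. -/
def locEmb (f : LocInt Ω) : AsympFun U Ω := distEmb U (schwartzEmb f)

end Regularization

end AsymptoticFunctions
end

open AsymptoticFunctions

/-!
Everything rests on four facts.

* *The cut-off is invisible near compact sets* (`ae_cutoff_eq_one`): for almost all `φ`, the
  function `C_{Ω,φ}` is `1` near a given compact `K ⊆ Ω` and `R_φ` is small, so that for
  `x ∈ K` the number `(T ⊛ φ)(x)` is just `T` applied to `t ↦ φ(x - t)`. Nets that are
  almost everywhere equal on each compact set define the same asymptotic function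
  (`AsympFun.mk_eq_mk_of_ae_eqOn`), because derivatives are local. This gives the
  compatibility with derivatives and restrictions.

* *Structure of distributions*: on test functions supported in a compact `K`, a distribution `T` is
  bounded by finitely many sup norms of partial derivatives (`Distr.exists_bound`), hence by the
  Hahn-Banach theorem it is a bounded functional `Λ` of finitely many elements `∂_l τ` of the Banach
  space `C(K, ℂ)` (`Distr.exists_repr`). A smooth family of test functions gives a smooth curve in
  that space, so `T` may be differentiated and integrated under its argument
  (`Distr.contDiff_family`, `Distr.fderiv_family`, `Distr.integral_family`). Consequently `T ⊛ φ` is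
  smooth with derivatives `T(C_{Ω,φ}(t) ∂^α φ(x - t))`; these are moderate by the bounds on the
  derivatives of `φ` in the definition of `𝒟_n` (`moderate_regFn`).

* *Taylor's formula with vanishing moments* (`norm_average_sub_le`): averaging a smooth function
  with a weight `φ ∈ 𝒟_n` changes it by `O(R_φ ^ (n + 1))`. For a smooth `f` the regularization is
  such an average, so `f ⊛ φ - f` is negligible, first without derivatives and then, as `∂_j`
  commutes with the embedding, with all of them (`locEmb_toLocInt`). For a distribution, Fubini's
  theorem turns the pairing of `T ⊛ φ` with `τ` into `T` applied to an average of `τ`, and all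
  derivatives of that average are close to those of `τ` (`pairing_distEmb`).

* A constant that is almost everywhere at most `R_φ` vanishes (`eq_zero_of_ae_norm_le`), so `ℂ`
  embeds into the asymptotic numbers, and the pairing formula makes the embedding of distributions
  injective. For locally integrable functions this is combined with the injectivity of the
  Schwartz embedding (`schwartzEmb_injective`).
-/

noncomputable section

namespace AsymptoticFunctions

/-! ### Iterated directional derivatives -/

section DirectionalDerivatives

variable {V : Type*} [NormedAddCommGroup V] [NormedSpace ℝ V]

/-- The derivative of `f` in the direction `v`, as a function of the base point. -/
def dirDeriv (v : V) (f : V → ℂ) (x : V) : ℂ := fderiv ℝ f x v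

/-- The iterated directional derivative of `f` along a list of directions; the last entry of the
list is applied first. -/
def iterDir (l : List V) (f : V → ℂ) : V → ℂ := l.foldr dirDeriv f

@[simp] theorem iterDir_nil (f : V → ℂ) : iterDir [] f = f := rfl

@[simp] theorem iterDir_cons (v : V) (l : List V) (f : V → ℂ) :
    iterDir (v :: l) f = dirDeriv v (iterDir l f) := rfl

theorem contDiff_dirDeriv {f : V → ℂ} (hf : ContDiff ℝ ∞ f) (v : V) :
    ContDiff ℝ ∞ (dirDeriv v f) :=
  (hf.fderiv_right (m := ∞) (by simp)).clm_apply contDiff_const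

theorem contDiff_iterDir {f : V → ℂ} (hf : ContDiff ℝ ∞ f) (l : List V) :
    ContDiff ℝ ∞ (iterDir l f) := by
  induction l with
  | nil => exact hf
  | cons v l ih => exact contDiff_dirDeriv ih v

theorem dirDeriv_comm {f : V → ℂ} (hf : ContDiff ℝ ∞ f) (v w : V) :
    dirDeriv v (dirDeriv w f) = dirDeriv w (dirDeriv v f) := by
  have key : ∀ (v w x : V), dirDeriv v (dirDeriv w f) x = fderiv ℝ (fderiv ℝ f) x v w := by
    intro v w x
    have hd : DifferentiableAt ℝ (fderiv ℝ f) x :=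
      ((hf.fderiv_right (m := ∞) (by simp)).differentiable (by simp)).differentiableAt
    change fderiv ℝ (fun y => fderiv ℝ f y w) x v = _
    rw [fderiv_clm_apply hd (differentiableAt_const _)]
    simp
  funext x
  rw [key, key]
  exact (hf.contDiffAt.isSymmSndFDerivAt
    (by simp only [minSmoothness_of_isRCLikeNormedField]; exact ENat.LEInfty.out)).eq _ _

theorem iterDir_dirDeriv {f : V → ℂ} (hf : ContDiff ℝ ∞ f) (l : List V) (v : V) :
    iterDir l (dirDeriv v f) = dirDeriv v (iterDir l f) := by
  induction l with
  | nil => rfl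
  | cons w l ih => rw [iterDir_cons, ih, dirDeriv_comm (contDiff_iterDir hf l), iterDir_cons]

theorem dirDeriv_sub {f g : V → ℂ} (hf : ContDiff ℝ ∞ f) (hg : ContDiff ℝ ∞ g) (v : V) :
    dirDeriv v (fun x => f x - g x) = fun x => dirDeriv v f x - dirDeriv v g x := by
  funext x
  rw [dirDeriv, fderiv_fun_sub (hf.differentiable (by simp)).differentiableAt
    (hg.differentiable (by simp)).differentiableAt]
  rfl

theorem iterDir_sub {f g : V → ℂ} (hf : ContDiff ℝ ∞ f) (hg : ContDiff ℝ ∞ g) (l : List V) :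
    iterDir l (fun x => f x - g x) = fun x => iterDir l f x - iterDir l g x := by
  induction l with
  | nil => rfl
  | cons v l ih =>
    rw [iterDir_cons, ih, dirDeriv_sub (contDiff_iterDir hf l) (contDiff_iterDir hg l)]
    rfl

theorem dirDeriv_eq_zero_of_eqOn_compl {f : V → ℂ} {K : Set V} (hK : IsClosed K)
    (hf : ∀ x ∉ K, f x = 0) (v : V) : ∀ x ∉ K, dirDeriv v f x = 0 := by
  intro x hx
  have : f =ᶠ[𝓝 x] fun _ => (0 : ℂ) := by
    filter_upwards [hK.isOpen_compl.mem_nhds hx] with y hy using hf y hy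
  rw [dirDeriv, this.fderiv_eq]
  simp

theorem iterDir_eq_zero_of_eqOn_compl {f : V → ℂ} {K : Set V} (hK : IsClosed K)
    (hf : ∀ x ∉ K, f x = 0) (l : List V) : ∀ x ∉ K, iterDir l f x = 0 := by
  induction l with
  | nil => exact hf
  | cons v l ih => exact dirDeriv_eq_zero_of_eqOn_compl hK ih v

theorem iteratedFDeriv_apply_eq_iterDir {f : V → ℂ} (hf : ContDiff ℝ ∞ f) (k : ℕ)
    (v : Fin k → V) (x : V) : iteratedFDeriv ℝ k f x v = iterDir (List.ofFn v) f x := by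
  induction k generalizing x with
  | zero => simp
  | succ k ih =>
    have hd : DifferentiableAt ℝ (iteratedFDeriv ℝ k f) x :=
      (hf.differentiable_iteratedFDeriv (m := k) (by exact_mod_cast ENat.natCast_lt_top k)) x
    rw [iteratedFDeriv_succ_apply_left, List.ofFn_succ, iterDir_cons, dirDeriv]
    have h2 : (fun y => iteratedFDeriv ℝ k f y (Fin.tail v)) =
        iterDir (List.ofFn fun i : Fin k => v i.succ) f := by
      funext y
      exact ih (Fin.tail v) y
    rw [← h2]
    have h3 := (ContinuousMultilinearMap.apply ℝ (fun _ : Fin k => V) ℂ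
      (Fin.tail v)).hasFDerivAt.comp x hd.hasFDerivAt
    have h4 : fderiv ℝ (fun y => iteratedFDeriv ℝ k f y (Fin.tail v)) x = _ := h3.fderiv
    rw [h4]
    rfl

end DirectionalDerivatives

section Euclidean

variable {d : ℕ}

/-- The list of basis vectors whose indices are the entries of a list. -/
def dirs (l : List (Fin d)) : List (Eucl d) := l.map basisVec

theorem eq_sum_basisVec (y : Eucl d) : y = ∑ i, y i • basisVec i := by
  ext j
  simp [basisVec, Pi.single_apply]

/-- The monomial expansion of the `k`-th derivative on the diagonal. -/
theorem iteratedFDeriv_diag_eq_sum {f : Eucl d → ℂ} (hf : ContDiff ℝ ∞ f) (k : ℕ) (x y : Eucl d) :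
    iteratedFDeriv ℝ k f x (fun _ => y) =
      ∑ r : Fin k → Fin d, ((∏ i, y (r i) : ℝ) : ℂ) * iterDir (dirs (List.ofFn r)) f x := by
  conv_lhs => rw [eq_sum_basisVec y]
  rw [ContinuousMultilinearMap.map_sum (iteratedFDeriv ℝ k f x)
    (fun _ j => y j • basisVec j)]
  refine Finset.sum_congr rfl fun r _ => ?_
  rw [ContinuousMultilinearMap.map_smul_univ, iteratedFDeriv_apply_eq_iterDir hf, dirs,
    List.map_ofFn, Complex.real_smul]
  rfl

theorem norm_iteratedFDeriv_le_of_iterDir {f : Eucl d → ℂ} (hf : ContDiff ℝ ∞ f) (k : ℕ)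
    (x : Eucl d) {B : ℝ} (hB : 0 ≤ B)
    (h : ∀ l : List (Fin d), l.length = k → ‖iterDir (dirs l) f x‖ ≤ B) :
    ‖iteratedFDeriv ℝ k f x‖ ≤ (d : ℝ) ^ k * B := by
  refine ContinuousMultilinearMap.opNorm_le_bound (by positivity) fun v => ?_
  have hv : v = fun i => ∑ j, v i j • basisVec j := funext fun i => eq_sum_basisVec (v i)
  conv_lhs => rw [hv]
  rw [ContinuousMultilinearMap.map_sum (iteratedFDeriv ℝ k f x)
    (fun i j => v i j • basisVec j)]
  have hterm : ∀ r : Fin k → Fin d,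
      ‖iteratedFDeriv ℝ k f x (fun i => v i (r i) • basisVec (r i))‖ ≤ B * ∏ i, ‖v i‖ := by
    intro r
    rw [ContinuousMultilinearMap.map_smul_univ, iteratedFDeriv_apply_eq_iterDir hf,
      norm_smul, mul_comm]
    gcongr
    · have := h (List.ofFn r) (by simp)
      rwa [dirs, List.map_ofFn] at this
    · rw [norm_prod]
      gcongr with i
      exact PiLp.norm_apply_le (v i) (r i)
  refine (norm_sum_le_of_le _ fun r _ => hterm r).trans (le_of_eq ?_)
  simp [mul_assoc]

theorem coe_testPartial {Ω : Opens (Eucl d)} (i : Fin d) (τ : 𝓓(Ω, ℂ)) :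
    (testPartial Ω i τ : Eucl d → ℂ) = dirDeriv (basisVec i) τ := by
  funext x
  rw [testPartial, TestFunction.lineDerivCLM_apply_of_le le_top,
    ((τ.contDiff.differentiable (by simp)).differentiableAt).lineDeriv_eq_fderiv]
  rfl

/-- The iterated partial derivative of a test function along a list of indices. -/
def testIter (Ω : Opens (Eucl d)) (l : List (Fin d)) (τ : 𝓓(Ω, ℂ)) : 𝓓(Ω, ℂ) :=
  l.foldr (fun i σ => testPartial Ω i σ) τ

theorem coe_testIter {Ω : Opens (Eucl d)} (l : List (Fin d)) (τ : 𝓓(Ω, ℂ)) :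
    (testIter Ω l τ : Eucl d → ℂ) = iterDir (dirs l) τ := by
  induction l with
  | nil => rfl
  | cons i l ih =>
    change (testPartial Ω i (testIter Ω l τ) : Eucl d → ℂ) = _
    rw [coe_testPartial, ih]
    rfl

theorem testPartial_comm {Ω : Opens (Eucl d)} (i j : Fin d) (τ : 𝓓(Ω, ℂ)) :
    testPartial Ω i (testPartial Ω j τ) = testPartial Ω j (testPartial Ω i τ) := by
  refine DFunLike.coe_injective ?_
  simp only [coe_testPartial]
  exact dirDeriv_comm τ.contDiff _ _

/-- Iterated partial derivatives along lists are the `∂^α` of multi-indices. -/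
theorem exists_multiIter_eq_testIter {Ω : Opens (Eucl d)} (l : List (Fin d)) :
    ∃ α : Fin d → ℕ, absIdx α = l.length ∧
      ∀ τ : 𝓓(Ω, ℂ), testIter Ω l τ = multiIter (fun i => testPartial Ω i) α τ := by
  induction l with
  | nil => exact ⟨0, by simp [absIdx], fun τ => (multiIter_zero _ τ).symm⟩
  | cons j l ih =>
    obtain ⟨α, hα, h⟩ := ih
    refine ⟨bumpIdx α j, by simp [absIdx, bumpIdx, Finset.sum_add_distrib, ← hα], fun τ => ?_⟩
    rw [multiIter_add_single _ (fun i j a => testPartial_comm i j a), ← h]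
    refine DFunLike.coe_injective ?_
    rw [coe_testIter, coe_testIter, coe_testPartial, iterDir_dirDeriv τ.contDiff]
    rfl

/-- The `∂^α` of multi-indices are iterated partial derivatives along lists. -/
theorem exists_testIter_eq_multiIter {Ω : Opens (Eucl d)} (α : Fin d → ℕ) :
    ∃ l : List (Fin d), l.length = absIdx α ∧
      ∀ τ : 𝓓(Ω, ℂ), multiIter (fun i => testPartial Ω i) α τ = testIter Ω l τ := by
  refine SmoothFn.deriv_induction (P := fun α => ∃ l : List (Fin d), l.length = absIdx α ∧
      ∀ τ : 𝓓(Ω, ℂ), multiIter (fun i => testPartial Ω i) α τ = testIter Ω l τ) ?_ ?_ α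
  · exact ⟨[], by simp [absIdx], fun τ => multiIter_zero _ τ⟩
  · rintro α j ⟨l, hl, h⟩
    refine ⟨j :: l, by simp [absIdx, bumpIdx, Finset.sum_add_distrib, hl], fun τ => ?_⟩
    rw [multiIter_add_single _ (fun i j a => testPartial_comm i j a), h]
    refine DFunLike.coe_injective ?_
    rw [coe_testIter, coe_testIter, coe_testPartial, iterDir_dirDeriv τ.contDiff]
    rfl

end Euclidean

/-! ### The structure of a distribution on a compact set -/

section Structure

variable {d : ℕ} {Ω : Opens (Eucl d)}

theorem Distr.exists_bound (T : Distr Ω) {K : Set (Eucl d)} (hK : IsCompact K)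
    (hKΩ : K ⊆ (Ω : Set (Eucl d))) :
    ∃ (N : ℕ) (C : ℝ), 0 ≤ C ∧ ∀ τ : 𝓓(Ω, ℂ), tsupport τ ⊆ K → ∀ B : ℝ, 0 ≤ B →
      (∀ l : List (Fin d), l.length ≤ N → ∀ x ∈ K, ‖iterDir (dirs l) τ x‖ ≤ B) →
      ‖T τ‖ ≤ C * B := by
  let K' : Compacts (Eucl d) := ⟨K, hK⟩
  let S : 𝓓^{⊤}_{K'}(Eucl d, ℂ) →L[ℂ] ℂ := T.comp (TestFunction.ofSupportedInCLM ℂ hKΩ)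
  obtain ⟨s, C, -, hC⟩ := Seminorm.bound_of_continuous
    (ContDiffMapSupportedIn.withSeminorms ℂ (Eucl d) ℂ ⊤ K')
    ((normSeminorm ℂ ℂ).comp S.toLinearMap) (continuous_norm.comp S.continuous)
  refine ⟨s.sup id, C * ∑ i ∈ s, (d : ℝ) ^ i, by positivity, fun τ hτ B hB h => ?_⟩
  let σ : 𝓓^{⊤}_{K'}(Eucl d, ℂ) := ContDiffMapSupportedIn.of_support_subset τ.contDiff
    ((subset_tsupport _).trans hτ)
  have hσ : T τ = S σ := by
    change T τ = T _
    congr 1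
  rw [hσ]
  refine (hC σ).trans ?_
  rw [_root_.smul_apply, mul_assoc, NNReal.smul_def, smul_eq_mul]
  gcongr
  refine Seminorm.finset_sup_apply_le (by positivity) fun i hi => ?_
  refine (ContDiffMapSupportedIn.seminorm_top_le_iff ℂ (by positivity) i σ).2 fun x hx => ?_
  refine (norm_iteratedFDeriv_le_of_iterDir σ.contDiff i x hB fun l hl => ?_).trans ?_
  · exact h l (hl ▸ Finset.le_sup (f := id) hi) x hx
  · gcongr
    exact Finset.single_le_sum (f := fun i => (d : ℝ) ^ i) (fun _ _ => by positivity) hi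

/-- The lists of at most `N` indices. -/
abbrev ShortList (d N : ℕ) : Type := {l : List (Fin d) // l.length ≤ N}

instance (N : ℕ) : Fintype (ShortList d N) :=
  Set.Finite.fintype (List.finite_length_le (Fin d) N)

/-- On test functions supported in a compact set `K`, a distribution is a bounded linear functional
of finitely many partial derivatives, each viewed as an element of the Banach space `C(K, ℂ)`. -/
theorem Distr.exists_repr (T : Distr Ω) {K : Set (Eucl d)} (hK : IsCompact K)
    (hKΩ : K ⊆ (Ω : Set (Eucl d))) [CompactSpace K] :
    ∃ (N : ℕ) (Λ : (ShortList d N → C(K, ℂ)) →L[ℂ] ℂ), ∀ (τ : 𝓓(Ω, ℂ)) (_ : tsupport τ ⊆ K)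
      (F : ShortList d N → C(K, ℂ)) (_ : ∀ l t, F l t = iterDir (dirs l.1) τ t), T τ = Λ F := by
  obtain ⟨N, C, hC0, hC⟩ := T.exists_bound hK hKΩ
  -- the test functions supported in `K`
  let M : Submodule ℂ 𝓓(Ω, ℂ) :=
    { carrier := {τ | ∀ t ∉ K, τ t = 0}
      zero_mem' := fun t _ => rfl
      add_mem' := fun {a b} ha hb t ht => by
        change a t + b t = 0
        rw [ha t ht, hb t ht, add_zero]
      smul_mem' := fun c a ha t ht => by
        change c • a t = 0
        rw [ha t ht, smul_zero] }
  have hM : ∀ τ : 𝓓(Ω, ℂ), (∀ t ∉ K, τ t = 0) → tsupport τ ⊆ K := fun τ h =>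
    closure_minimal (fun t ht => by_contra fun hc => ht (h t hc)) hK.isClosed
  let D : List (Fin d) → 𝓓(Ω, ℂ) →ₗ[ℂ] 𝓓(Ω, ℂ) := fun l =>
    l.foldr (fun i A => (testPartial Ω i).toLinearMap ∘ₗ A) LinearMap.id
  have hD : ∀ l τ, D l τ = testIter Ω l τ := by
    intro l τ
    induction l with
    | nil => rfl
    | cons i l ih =>
      change testPartial Ω i (D l τ) = testPartial Ω i (testIter Ω l τ)
      rw [ih]
  -- the tuple of the partial derivatives; `T` factors through it by the bound `hC`
  let J : M →ₗ[ℂ] (ShortList d N → C(K, ℂ)) :=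
    { toFun := fun τ l => ⟨fun t => D l.1 τ.1 t, (D l.1 τ.1).continuous.comp continuous_subtype_val⟩
      map_add' := fun a b => by
        funext l; ext t
        change D l.1 (a.1 + b.1) t = D l.1 a.1 t + D l.1 b.1 t
        rw [map_add]; rfl
      map_smul' := fun c a => by
        funext l; ext t
        change D l.1 (c • a.1) t = c • D l.1 a.1 t
        rw [map_smul]; rfl }
  have hJ : ∀ τ : M, ‖T τ.1‖ ≤ C * ‖J τ‖ := by
    intro τ
    refine hC τ.1 (hM τ.1 τ.2) _ (norm_nonneg _) fun l hl x hx => ?_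
    have h1 := (ContinuousMap.norm_coe_le_norm (J τ ⟨l, hl⟩) ⟨x, hx⟩).trans
      (norm_le_pi_norm (J τ) ⟨l, hl⟩)
    have h2 : J τ ⟨l, hl⟩ ⟨x, hx⟩ = iterDir (dirs l) τ.1 x := by
      rw [← coe_testIter, ← hD]; rfl
    rwa [h2] at h1
  let f : LinearMap.range J →ₗ[ℂ] ℂ := descend J.rangeRestrict J.surjective_rangeRestrict
    (T.toLinearMap ∘ₗ M.subtype) (fun m hm => by
      have h0 : J m = 0 := congrArg Subtype.val hm
      have := hJ m
      rw [h0, norm_zero, mul_zero, norm_le_zero_iff] at this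
      exact this)
  have hf : ∀ τ : M, f (J.rangeRestrict τ) = T τ.1 := fun τ => descend_apply _ _ _ _ τ
  obtain ⟨Λ, hΛ, -⟩ := exists_extension_norm_eq (LinearMap.range J) (f.mkContinuous C (fun y => by
    obtain ⟨τ, rfl⟩ := J.surjective_rangeRestrict y
    rw [hf]
    exact hJ τ))
  refine ⟨N, Λ, fun τ hτ F hF => ?_⟩
  have hτM : τ ∈ M := fun t ht => image_eq_zero_of_notMem_tsupport (fun h => ht (hτ h))
  have hFJ : F = J ⟨τ, hτM⟩ := by
    funext l; ext t
    rw [hF, ← coe_testIter, ← hD]; rfl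
  rw [hFJ, ← hf ⟨τ, hτM⟩]
  exact (hΛ (J.rangeRestrict ⟨τ, hτM⟩)).symm

end Structure

/-! ### Distributions applied to smooth families of test functions -/

section Families

variable {d : ℕ}

/-- The map `x ↦ H (x, ·)` with values in the continuous functions on `K`. -/
def slice (K : Set (Eucl d)) (H : Eucl d × Eucl d → ℂ) (hH : Continuous H) (x : Eucl d) :
    C(K, ℂ) :=
  ⟨fun t => H (x, t), by fun_prop⟩

theorem continuous_slice (K : Set (Eucl d)) {H : Eucl d × Eucl d → ℂ} (hH : Continuous H) :
    Continuous (slice K H hH) :=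
  (ContinuousMap.curry (⟨fun p : Eucl d × K => H (p.1, p.2), by fun_prop⟩ :
    C(Eucl d × K, ℂ))).continuous

/-- The curve `x ↦ H (x, ·)` in `C(K, ℂ)` is differentiable: by compactness of `K`, the mean value
inequality bounds the error uniformly over `K`. -/
theorem hasFDerivAt_slice (K : Set (Eucl d)) [CompactSpace K] {H : Eucl d × Eucl d → ℂ}
    (hH : ContDiff ℝ ∞ H) (x : Eucl d) :
    ∃ A : Eucl d →L[ℝ] C(K, ℂ),
      (∀ v, A v = slice K (dirDeriv (v, 0) H) (contDiff_dirDeriv hH _).continuous x) ∧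
      HasFDerivAt (slice K H hH.continuous) A x := by
  let A : Eucl d →ₗ[ℝ] C(K, ℂ) :=
    { toFun := fun v => slice K (dirDeriv (v, 0) H) (contDiff_dirDeriv hH _).continuous x
      map_add' := fun v w => by
        ext t
        change fderiv ℝ H (x, t) (v + w, 0) = fderiv ℝ H (x, t) (v, 0) + fderiv ℝ H (x, t) (w, 0)
        rw [← map_add]; simp
      map_smul' := fun c v => by
        ext t
        change fderiv ℝ H (x, t) (c • v, 0) = c • fderiv ℝ H (x, t) (v, 0)
        rw [← map_smul]; simp }
  refine ⟨LinearMap.toContinuousLinearMap A, fun v => rfl, ?_⟩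
  -- the partial derivative of `H` in the first variable, uniformly over `K`
  let P : Eucl d × Eucl d → (Eucl d →L[ℝ] ℂ) := fun p =>
    (fderiv ℝ H p).comp (ContinuousLinearMap.inl ℝ (Eucl d) (Eucl d))
  have hP : Continuous P :=
    ((hH.fderiv_right (m := ∞) (by simp)).continuous).clm_comp continuous_const
  let Q : C(Eucl d, C(K, Eucl d →L[ℝ] ℂ)) :=
    ContinuousMap.curry ⟨fun p : Eucl d × K => P (p.1, p.2), by fun_prop⟩
  rw [hasFDerivAt_iff_isLittleO]
  refine Asymptotics.isLittleO_iff.2 fun ε hε => ?_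
  obtain ⟨δ, hδ, hball⟩ :=
    (Metric.continuousAt_iff (f := Q) (a := x)).1 Q.continuous.continuousAt ε hε
  filter_upwards [Metric.ball_mem_nhds x hδ] with y hy
  refine (ContinuousMap.norm_le _ (by positivity)).2 fun t => ?_
  have hder : ∀ z, HasFDerivAt (fun z => H (z, (t : Eucl d))) (P (z, t)) z := by
    intro z
    have h1 : HasFDerivAt (fun z : Eucl d => (z, (t : Eucl d)))
        (ContinuousLinearMap.inl ℝ (Eucl d) (Eucl d)) z := hasFDerivAt_prodMk_left z _
    exact ((hH.differentiable (by simp)).differentiableAt.hasFDerivAt).comp z h1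
  refine (convex_ball x δ).norm_image_sub_le_of_norm_hasFDerivWithin_le'
    (f := fun z => H (z, (t : Eucl d))) (φ := P (x, t))
    (fun z _ => (hder z).hasFDerivWithinAt) (fun z hz => ?_) (Metric.mem_ball_self hδ) hy
  have h2 := (ContinuousMap.dist_apply_le_dist (f := Q z) (g := Q x) t).trans_lt (hball hz)
  rw [dist_eq_norm] at h2
  exact h2.le

theorem contDiff_slice (K : Set (Eucl d)) [CompactSpace K] {H : Eucl d × Eucl d → ℂ}
    (hH : ContDiff ℝ ∞ H) : ContDiff ℝ ∞ (slice K H hH.continuous) := by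
  refine contDiff_infty.2 fun n => ?_
  induction n generalizing H with
  | zero => exact contDiff_zero.2 (continuous_slice K hH.continuous)
  | succ n ih =>
    push_cast
    refine contDiff_succ_iff_fderiv_apply.2 ⟨fun x => ?_, by simp, fun v => ?_⟩
    · obtain ⟨A, -, hA⟩ := hasFDerivAt_slice K hH x
      exact hA.differentiableAt
    · convert ih (contDiff_dirDeriv hH (v, 0)) using 1
      funext x
      obtain ⟨A, hAv, hA⟩ := hasFDerivAt_slice K hH x
      rw [hA.fderiv, hAv]

theorem iterDir_slice {H : Eucl d × Eucl d → ℂ} (hH : ContDiff ℝ ∞ H) (l : List (Eucl d))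
    (x : Eucl d) :
    iterDir l (fun t => H (x, t)) =
      fun t => iterDir (l.map fun v => ((0 : Eucl d), v)) H (x, t) := by
  induction l with
  | nil => rfl
  | cons v l ih =>
    rw [iterDir_cons, ih]
    funext t
    have h1 : HasFDerivAt (fun t : Eucl d => (x, t))
        (ContinuousLinearMap.inr ℝ (Eucl d) (Eucl d)) t := hasFDerivAt_prodMk_right x t
    have h2 := (((contDiff_iterDir hH (l.map fun v => ((0 : Eucl d), v))).differentiable
      (by simp)).differentiableAt.hasFDerivAt (x := (x, t))).comp t h1
    change fderiv ℝ (fun t => iterDir (l.map fun v => ((0 : Eucl d), v)) H (x, t)) t v = _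
    have h3 : fderiv ℝ (fun t => iterDir (l.map fun v => ((0 : Eucl d), v)) H (x, t)) t = _ :=
      h2.fderiv
    rw [h3]
    rfl

variable {Ω : Opens (Eucl d)}

/-- The functional of `Distr.exists_repr`, evaluated on a smooth family of test functions: its
argument is then a tuple of slices of partial derivatives of `H`. -/
theorem Distr.exists_repr_family (T : Distr Ω) {K : Set (Eucl d)} (hK : IsCompact K)
    (hKΩ : K ⊆ (Ω : Set (Eucl d))) [CompactSpace K] :
    ∃ (N : ℕ) (Λ : (ShortList d N → C(K, ℂ)) →L[ℂ] ℂ),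
      (∀ (τ : 𝓓(Ω, ℂ)) (_ : tsupport τ ⊆ K)
        (F : ShortList d N → C(K, ℂ)) (_ : ∀ l t, F l t = iterDir (dirs l.1) τ t), T τ = Λ F) ∧
      ∀ (H : Eucl d × Eucl d → ℂ) (hH : ContDiff ℝ ∞ H) (τ : Eucl d → 𝓓(Ω, ℂ)),
        (∀ x t, τ x t = H (x, t)) → (∀ x, tsupport (τ x) ⊆ K) →
        ∀ x, T (τ x) = Λ (fun l => slice K (iterDir ((dirs l.1).map fun v => ((0 : Eucl d), v)) H)
          (contDiff_iterDir hH _).continuous x) := by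
  obtain ⟨N, Λ, h⟩ := T.exists_repr hK hKΩ
  refine ⟨N, Λ, h, fun H hH τ hτ hs x => h (τ x) (hs x) _ fun l t => ?_⟩
  have : (τ x : Eucl d → ℂ) = fun t => H (x, t) := funext (hτ x)
  rw [this, iterDir_slice hH]
  rfl

theorem Distr.contDiff_family (T : Distr Ω) {K : Set (Eucl d)} (hK : IsCompact K)
    (hKΩ : K ⊆ (Ω : Set (Eucl d))) {H : Eucl d × Eucl d → ℂ} (hH : ContDiff ℝ ∞ H)
    {τ : Eucl d → 𝓓(Ω, ℂ)} (hτ : ∀ x t, τ x t = H (x, t)) (hs : ∀ x, tsupport (τ x) ⊆ K) :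
    ContDiff ℝ ∞ (fun x => T (τ x)) := by
  have : CompactSpace K := isCompact_iff_compactSpace.1 hK
  obtain ⟨N, Λ, -, h⟩ := T.exists_repr_family hK hKΩ
  simp only [h H hH τ hτ hs]
  exact (Λ.restrictScalars ℝ).contDiff.comp
    (contDiff_pi.2 fun l => contDiff_slice K (contDiff_iterDir hH _))

/-- A distribution may be differentiated under its argument. -/
theorem Distr.fderiv_family (T : Distr Ω) {K : Set (Eucl d)} (hK : IsCompact K)
    (hKΩ : K ⊆ (Ω : Set (Eucl d))) {H : Eucl d × Eucl d → ℂ} (hH : ContDiff ℝ ∞ H)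
    {τ τ' : Eucl d → 𝓓(Ω, ℂ)} (hτ : ∀ x t, τ x t = H (x, t)) (hs : ∀ x, tsupport (τ x) ⊆ K)
    (v : Eucl d) (hτ' : ∀ x t, τ' x t = dirDeriv (v, 0) H (x, t))
    (hs' : ∀ x, tsupport (τ' x) ⊆ K) (x : Eucl d) :
    fderiv ℝ (fun x => T (τ x)) x v = T (τ' x) := by
  have : CompactSpace K := isCompact_iff_compactSpace.1 hK
  obtain ⟨N, Λ, -, h⟩ := T.exists_repr_family hK hKΩ
  rw [h _ (contDiff_dirDeriv hH (v, 0)) τ' hτ' hs']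
  simp only [h H hH τ hτ hs]
  choose A hA hAd using fun l : ShortList d N => hasFDerivAt_slice K
    (contDiff_iterDir hH ((dirs l.1).map fun v => ((0 : Eucl d), v))) x
  have h1 := (Λ.restrictScalars ℝ).hasFDerivAt.comp x (hasFDerivAt_pi.2 hAd)
  have h2 : fderiv ℝ (fun x => Λ (fun l : ShortList d N => slice K
    (iterDir ((dirs l.1).map fun v => ((0 : Eucl d), v)) H)
          (contDiff_iterDir hH _).continuous x)) x = _ := h1.fderiv
  rw [h2]
  change Λ (fun l => A l v) = _
  congr 1
  funext l
  rw [hA]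
  congr 1
  exact (iterDir_dirDeriv hH _ _).symm

end Families

/-! ### Integrals of smooth families -/

section Fubini

variable {d : ℕ}

/-- Lebesgue measure, as a distribution on `ℝ^d`. -/
def lebesgueDistr (d : ℕ) : Distr (⊤ : Opens (Eucl d)) :=
  TestFunction.integralAgainstBilinCLM (ContinuousLinearMap.mul ℂ ℂ) volume (fun _ => (1 : ℂ))

theorem lebesgueDistr_apply (τ : TestFn d) : lebesgueDistr d τ = ∫ x, τ x := by
  rw [lebesgueDistr, TestFunction.integralAgainstBilinCLM_eq_integral
    ((locallyIntegrable_const _).locallyIntegrableOn _)]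
  simp

theorem tsupport_subset_of_eqOn_compl {f : Eucl d → ℂ} {K : Set (Eucl d)} (hK : IsCompact K)
    (h : ∀ x ∉ K, f x = 0) : tsupport f ⊆ K :=
  closure_minimal (fun t ht => by_contra fun hc => ht (h t hc)) hK.isClosed

/-- The test function with the values of a smooth function vanishing off a compact set. -/
def mkTest {Ω : Opens (Eucl d)} {K : Set (Eucl d)} (hK : IsCompact K)
    (hKΩ : K ⊆ (Ω : Set (Eucl d))) (f : Eucl d → ℂ) (hf : ContDiff ℝ ∞ f)
    (h : ∀ x ∉ K, f x = 0) : 𝓓(Ω, ℂ) where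
  toFun := f
  contDiff' := hf
  hasCompactSupport' := HasCompactSupport.intro hK h
  tsupport_subset' := (tsupport_subset_of_eqOn_compl hK h).trans hKΩ

theorem dirDeriv_swap {H : Eucl d × Eucl d → ℂ} (hH : ContDiff ℝ ∞ H) (v t x : Eucl d) :
    dirDeriv (v, 0) (fun p : Eucl d × Eucl d => H p.swap) (t, x) = dirDeriv (0, v) H (x, t) := by
  have h1 : HasFDerivAt (Prod.swap : Eucl d × Eucl d → Eucl d × Eucl d)
      (ContinuousLinearEquiv.prodComm ℝ (Eucl d) (Eucl d) : _ →L[ℝ] _) (t, x) :=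
    (ContinuousLinearEquiv.prodComm ℝ (Eucl d) (Eucl d)).hasFDerivAt
  have h2 := ((hH.differentiable (by simp)).differentiableAt.hasFDerivAt
    (x := Prod.swap (t, x))).comp (t, x) h1
  have h3 : fderiv ℝ (fun p : Eucl d × Eucl d => H p.swap) (t, x) = _ := h2.fderiv
  rw [dirDeriv, h3]
  rfl

theorem integral_family_aux {H : Eucl d × Eucl d → ℂ} (hH : ContDiff ℝ ∞ H) {L : Set (Eucl d)}
    (hL : IsCompact L) (hs : ∀ x ∉ L, ∀ t, H (x, t) = 0) :
    ContDiff ℝ ∞ (fun t => ∫ x, H (x, t)) ∧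
      ∀ v, dirDeriv v (fun t => ∫ x, H (x, t)) = fun t => ∫ x, dirDeriv (0, v) H (x, t) := by
  have hH' : ContDiff ℝ ∞ (fun p : Eucl d × Eucl d => H p.swap) := 
    hH.comp (contDiff_snd.prodMk contDiff_fst)
  have hslice : ∀ {G : Eucl d × Eucl d → ℂ}, ContDiff ℝ ∞ G → ∀ t,
      ContDiff ℝ ∞ (fun x => G (x, t)) := fun hG t => hG.comp (contDiff_id.prodMk contDiff_const)
  have hd : ∀ v : Eucl d, ∀ x ∉ L, ∀ t, dirDeriv (0, v) H (x, t) = 0 := fun v x hx t =>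
    dirDeriv_eq_zero_of_eqOn_compl (K := Prod.fst ⁻¹' L) (hL.isClosed.preimage continuous_fst)
      (fun p hp => hs p.1 hp p.2) _ (x, t) hx
  -- the integral is Lebesgue measure applied to a family in which the variables are exchanged
  let τ : Eucl d → TestFn d := fun t => mkTest hL (Set.subset_univ _) (fun x => H (x, t))
    (hslice hH t) (fun x hx => hs x hx t)
  have hτ : (fun t => ∫ x, H (x, t)) = fun t => lebesgueDistr d (τ t) := by
    funext t
    rw [lebesgueDistr_apply]
    rfl
  have hsupp : ∀ t, tsupport (τ t) ⊆ L := fun t =>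
    tsupport_subset_of_eqOn_compl hL (fun x hx => hs x hx t)
  rw [hτ]
  refine ⟨(lebesgueDistr d).contDiff_family hL (Set.subset_univ _) hH' (fun _ _ => rfl) hsupp,
    fun v => funext fun t => ?_⟩
  let τ' : Eucl d → TestFn d := fun t => mkTest hL (Set.subset_univ _)
    (fun x => dirDeriv (0, v) H (x, t)) (hslice (contDiff_dirDeriv hH _) t)
    (fun x hx => hd v x hx t)
  have h := (lebesgueDistr d).fderiv_family hL (Set.subset_univ _) hH' (τ := τ) (τ' := τ')
    (fun _ _ => rfl) hsupp v (fun t x => (dirDeriv_swap hH v t x).symm)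
    (fun t => tsupport_subset_of_eqOn_compl hL (fun x hx => hd v x hx t)) t
  rw [dirDeriv, h, lebesgueDistr_apply]
  rfl

theorem contDiff_integral_family {H : Eucl d × Eucl d → ℂ} (hH : ContDiff ℝ ∞ H)
    {L : Set (Eucl d)} (hL : IsCompact L) (hs : ∀ x ∉ L, ∀ t, H (x, t) = 0) :
    ContDiff ℝ ∞ (fun t => ∫ x, H (x, t)) := (integral_family_aux hH hL hs).1

theorem iterDir_eq_zero_of_fst_notMem {H : Eucl d × Eucl d → ℂ} {L : Set (Eucl d)}
    (hL : IsClosed L) (hs : ∀ x ∉ L, ∀ t, H (x, t) = 0) (l : List (Eucl d × Eucl d)) :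
    ∀ x ∉ L, ∀ t, iterDir l H (x, t) = 0 := fun x hx t =>
  iterDir_eq_zero_of_eqOn_compl (K := Prod.fst ⁻¹' L) (hL.preimage continuous_fst)
      (fun p hp => hs p.1 hp p.2) _ (x, t) hx

theorem iterDir_integral_family {H : Eucl d × Eucl d → ℂ} (hH : ContDiff ℝ ∞ H)
    {L : Set (Eucl d)} (hL : IsCompact L) (hs : ∀ x ∉ L, ∀ t, H (x, t) = 0)
    (l : List (Eucl d)) :
    iterDir l (fun t => ∫ x, H (x, t)) =
      fun t => ∫ x, iterDir (l.map fun v => ((0 : Eucl d), v)) H (x, t) := by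
  induction l with
  | nil => rfl
  | cons v l ih =>
    rw [iterDir_cons, ih, (integral_family_aux (contDiff_iterDir hH _) hL
      (iterDir_eq_zero_of_fst_notMem hL.isClosed hs _)).2]
    rfl

variable {Ω : Opens (Eucl d)}

/-- Fubini's theorem: a distribution may be applied under the integral of a smooth family of
test functions. -/
theorem Distr.integral_family (T : Distr Ω) {K L : Set (Eucl d)} (hK : IsCompact K)
    (hKΩ : K ⊆ (Ω : Set (Eucl d))) (hL : IsCompact L) {H : Eucl d × Eucl d → ℂ}
    (hH : ContDiff ℝ ∞ H) (hs : ∀ x ∉ L, ∀ t, H (x, t) = 0)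
    {τ : Eucl d → 𝓓(Ω, ℂ)} (hτ : ∀ x t, τ x t = H (x, t)) (hτK : ∀ x, tsupport (τ x) ⊆ K)
    {σ : 𝓓(Ω, ℂ)} (hσ : ∀ t, σ t = ∫ x, H (x, t)) (hσK : tsupport σ ⊆ K) :
    T σ = ∫ x, T (τ x) := by
  have : CompactSpace K := isCompact_iff_compactSpace.1 hK
  obtain ⟨N, Λ, h0, h⟩ := T.exists_repr_family hK hKΩ
  simp only [h H hH τ hτ hτK]
  let F : Eucl d → ShortList d N → C(K, ℂ) := fun x l => slice K
    (iterDir ((dirs l.1).map fun v => ((0 : Eucl d), v)) H) (contDiff_iterDir hH _).continuous x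
  have hFc : Continuous F := continuous_pi fun l => continuous_slice K _
  have hFi : Integrable F := hFc.integrable_of_hasCompactSupport
    (HasCompactSupport.intro hL fun x hx => by
      funext l; ext t
      exact iterDir_eq_zero_of_fst_notMem hL.isClosed hs _ x hx t)
  change _ = ∫ x, Λ (F x)
  rw [ContinuousLinearMap.integral_comp_comm Λ hFi]
  refine h0 σ hσK _ fun l t => ?_
  have hev := ContinuousLinearMap.integral_comp_comm
    ((ContinuousMap.evalCLM ℂ t).comp (ContinuousLinearMap.proj (R := ℂ)
      (φ := fun _ : ShortList d N => C(K, ℂ)) l)) hFi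
  have hσ' : (σ : Eucl d → ℂ) = fun t => ∫ x, H (x, t) := funext hσ
  rw [hσ', iterDir_integral_family hH hL hs]
  exact hev.symm

end Fubini

/-! ### Taylor's formula and vanishing moments -/

section Moments

variable {d : ℕ}

theorem iteratedDeriv_line {f : Eucl d → ℂ} (hf : ContDiff ℝ ∞ f) (x y : Eucl d) (k : ℕ) :
    iteratedDeriv k (fun s : ℝ => f (x + s • y)) =
      fun s => iteratedFDeriv ℝ k f (x + s • y) (fun _ => y) := by
  have key : iteratedDeriv k (fun s : ℝ => f (x + s • y)) =
      fun s => iterDir (List.replicate k y) f (x + s • y) := by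
    induction k with
    | zero => simp
    | succ k ih =>
      rw [iteratedDeriv_succ, ih]
      funext s
      have h1 : HasDerivAt (fun s : ℝ => x + s • y) y s := by
        simpa using ((hasDerivAt_id s).smul_const y).const_add x
      have h2 := ((contDiff_iterDir hf (List.replicate k y)).differentiable
        (by simp)).differentiableAt.hasFDerivAt (x := x + s • y)
      exact (h2.comp_hasDerivAt s h1).deriv
  rw [key]
  funext s
  rw [iteratedFDeriv_apply_eq_iterDir hf, List.ofFn_const]

/-- Taylor's formula of order `n`, with a remainder bounded in terms of the derivatives of order
`n + 1`. -/
theorem norm_sub_taylor_le {f : Eucl d → ℂ} (hf : ContDiff ℝ ∞ f) {n : ℕ} {M : ℝ}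
    (hM : ∀ x, ‖iteratedFDeriv ℝ (n + 1) f x‖ ≤ M) (x y : Eucl d) :
    ‖f (x + y) - ∑ k ∈ Finset.range (n + 1),
      ((k.factorial : ℝ)⁻¹ : ℝ) • iteratedFDeriv ℝ k f x (fun _ => y)‖ ≤ M * ‖y‖ ^ (n + 1) := by
  have hg : ContDiff ℝ ∞ (fun s : ℝ => f (x + s • y)) := hf.comp (by fun_prop)
  have hu : UniqueDiffOn ℝ (Set.Icc (0 : ℝ) 1) := uniqueDiffOn_Icc zero_lt_one
  have hW : ∀ k, ∀ s ∈ Set.Icc (0 : ℝ) 1,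
      iteratedDerivWithin k (fun s : ℝ => f (x + s • y)) (Set.Icc 0 1) s =
        iteratedFDeriv ℝ k f (x + s • y) (fun _ => y) := fun k s hs => by
    rw [iteratedDerivWithin_eq_iteratedDeriv hu
      ((hg.of_le (by exact_mod_cast le_top)).contDiffAt) hs, iteratedDeriv_line hf]
  have hM0 : 0 ≤ M := (norm_nonneg _).trans (hM x)
  have h := taylor_mean_remainder_bound (f := fun s : ℝ => f (x + s • y)) (n := n) (x := 1)
    (C := M * ‖y‖ ^ (n + 1)) zero_le_one
    ((hg.of_le (by exact_mod_cast le_top)).contDiffOn) ⟨zero_le_one, le_rfl⟩ (fun s hs => by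
      rw [hW _ s hs]
      refine (ContinuousMultilinearMap.le_opNorm _ _).trans ?_
      rw [Finset.prod_const, Finset.card_univ, Fintype.card_fin]
      gcongr
      exact hM _)
  rw [taylor_within_apply] at h
  have hsum : ∑ k ∈ Finset.range (n + 1), ((k.factorial : ℝ)⁻¹ * (1 - 0) ^ k) •
      iteratedDerivWithin k (fun s : ℝ => f (x + s • y)) (Set.Icc 0 1) 0 =
      ∑ k ∈ Finset.range (n + 1),
      ((k.factorial : ℝ)⁻¹ : ℝ) • iteratedFDeriv ℝ k f x (fun _ => y) := by
    refine Finset.sum_congr rfl fun k _ => ?_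
    rw [hW k 0 ⟨le_rfl, zero_le_one⟩]
    simp
  rw [hsum] at h
  simp only [one_smul, sub_zero, one_pow, mul_one] at h
  refine h.trans (div_le_self (by positivity) ?_)
  exact_mod_cast Nat.one_le_iff_ne_zero.2 n.factorial_ne_zero

theorem prod_apply_eq_prod_pow {k : ℕ} (r : Fin k → Fin d) (y : Eucl d) :
    ∏ i, y (r i) = ∏ j, y j ^ (Finset.univ.filter fun i => r i = j).card := by
  rw [← Finset.prod_fiberwise Finset.univ r (fun i => y (r i))]
  refine Finset.prod_congr rfl fun j _ => ?_
  rw [Finset.prod_congr rfl (g := fun _ => y j)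
    (fun i hi => by rw [(Finset.mem_filter.1 hi).2]), Finset.prod_const]

theorem integral_monomial_mul_eq_zero {φ : TestFn d} {n : ℕ} (hn : 1 ≤ n)
    (hφ : φ ∈ directingSet d n) {k : ℕ} (hk1 : 1 ≤ k) (hkn : k ≤ n) (r : Fin k → Fin d) :
    ∫ y : Eucl d, ((∏ i, y (r i) : ℝ) : ℂ) * φ y = 0 := by
  have hc : absIdx (fun j => (Finset.univ.filter fun i => r i = j).card) = k := by
    rw [absIdx, ← Finset.card_eq_sum_card_fiberwise (f := r) (t := Finset.univ)
      (by intro i _; simp)]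
    simp
  have := (hφ hn).2.2.2.2.1 (fun j => (Finset.univ.filter fun i => r i = j).card)
    (by rw [hc]; exact hk1) (by rw [hc]; exact hkn)
  simp only [prod_apply_eq_prod_pow]
  exact this

theorem integrable_mul_test {Ω : Opens (Eucl d)} {g : Eucl d → ℂ} (hg : Continuous g)
    (φ : 𝓓(Ω, ℂ)) : Integrable (fun y => φ y * g y) :=
  (φ.continuous.mul hg).integrable_of_hasCompactSupport (φ.hasCompactSupport.mul_right)

theorem integral_mul_taylor {φ : TestFn d} {n : ℕ} (hn : 1 ≤ n)
    (hφ : φ ∈ directingSet d n) {f : Eucl d → ℂ} (hf : ContDiff ℝ ∞ f) (x : Eucl d) :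
    ∫ y, φ y * ∑ k ∈ Finset.range (n + 1),
      ((k.factorial : ℝ)⁻¹ : ℝ) • iteratedFDeriv ℝ k f x (fun _ => y) = f x := by
  have hmon : ∀ (k : ℕ) (r : Fin k → Fin d),
      Continuous (fun y : Eucl d => ((∏ i, y (r i) : ℝ) : ℂ)) := fun k r => by fun_prop
  have hk : ∀ k : ℕ, ∀ y : Eucl d, φ y * (((k.factorial : ℝ)⁻¹ : ℝ) •
      iteratedFDeriv ℝ k f x (fun _ => y)) = ∑ r : Fin k → Fin d,
        ((((k.factorial : ℝ)⁻¹ : ℝ) : ℂ) * iterDir (dirs (List.ofFn r)) f x) *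
          (((∏ i, y (r i) : ℝ) : ℂ) * φ y) := by
    intro k y
    rw [iteratedFDeriv_diag_eq_sum hf, Complex.real_smul, Finset.mul_sum, Finset.mul_sum]
    refine Finset.sum_congr rfl fun r _ => ?_
    ring
  have hint : ∀ (k : ℕ) (r : Fin k → Fin d), Integrable (fun y : Eucl d =>
        ((((k.factorial : ℝ)⁻¹ : ℝ) : ℂ) * iterDir (dirs (List.ofFn r)) f x) *
          (((∏ i, y (r i) : ℝ) : ℂ) * φ y)) := fun k r => by
    refine Integrable.const_mul ?_ _
    simpa only [mul_comm] using integrable_mul_test (hmon k r) φ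
  simp only [Finset.mul_sum, hk]
  rw [integral_finsetSum _ fun k _ => integrable_finsetSum _ fun r _ => hint k r]
  -- split off the term of order zero, the only one that survives
  rw [Finset.sum_range_succ']
  have hz : ∀ k ∈ Finset.range n, ∫ y : Eucl d, ∑ r : Fin (k + 1) → Fin d,
        (((((k + 1).factorial : ℝ)⁻¹ : ℝ) : ℂ) * iterDir (dirs (List.ofFn r)) f x) *
          (((∏ i, y (r i) : ℝ) : ℂ) * φ y) = 0 := by
    intro k hkn
    rw [integral_finsetSum _ fun r _ => hint (k + 1) r]
    refine Finset.sum_eq_zero fun r _ => ?_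
    rw [integral_const_mul, integral_monomial_mul_eq_zero hn hφ (by omega)
      (by have := Finset.mem_range.1 hkn; omega), mul_zero]
  rw [Finset.sum_eq_zero hz, zero_add]
  have h1 := (hφ hn).2.2.2.1
  simp [integral_const_mul, h1, dirs]

theorem suppRadius_nonneg (φ : TestFn d) : 0 ≤ suppRadius φ := by
  rw [suppRadius]
  split_ifs
  · exact zero_le_one
  · exact Real.sSup_nonneg (by rintro r ⟨x, -, rfl⟩; exact norm_nonneg _)

/-- Averaging a smooth function with a weight from `𝒟_n` reproduces it up to `O(R_φ ^ (n + 1))`: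
the moment conditions remove all terms of the Taylor polynomial except the first. -/
theorem norm_average_sub_le {φ : TestFn d} {n : ℕ} (hn : 1 ≤ n)
    (hφ : φ ∈ directingSet d n) {f : Eucl d → ℂ} (hf : ContDiff ℝ ∞ f) {M : ℝ}
    (hM : ∀ x, ‖iteratedFDeriv ℝ (n + 1) f x‖ ≤ M) (x : Eucl d) :
    ‖f x - ∫ y, φ y * f (x + y)‖ ≤ 2 * M * suppRadius φ ^ (n + 1) := by
  have hM0 : 0 ≤ M := (norm_nonneg _).trans (hM x)
  have hc : ∀ k : ℕ, Continuous (fun y : Eucl d => iteratedFDeriv ℝ k f x (fun _ => y)) :=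
    fun k => (iteratedFDeriv ℝ k f x).cont.comp (continuous_pi fun _ => continuous_id)
  have hcs : Continuous (fun y : Eucl d => ∑ k ∈ Finset.range (n + 1),
      ((k.factorial : ℝ)⁻¹ : ℝ) • iteratedFDeriv ℝ k f x (fun _ => y)) :=
    continuous_finsetSum _ fun k _ => (hc k).fun_const_smul _
  have hfc : Continuous (fun y : Eucl d => f (x + y)) := hf.continuous.comp (by fun_prop)
  rw [← integral_mul_taylor hn hφ hf x,
    ← integral_sub (integrable_mul_test hcs φ) (integrable_mul_test hfc φ)]
  have hφi : Integrable (fun y => ‖φ y‖) :=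
    (φ.continuous.integrable_of_hasCompactSupport φ.hasCompactSupport).norm
  have hbd : ∀ y, ‖φ y * ∑ k ∈ Finset.range (n + 1),
      ((k.factorial : ℝ)⁻¹ : ℝ) • iteratedFDeriv ℝ k f x (fun _ => y) - φ y * f (x + y)‖ ≤
      (M * suppRadius φ ^ (n + 1)) * ‖φ y‖ := by
    intro y
    rw [← mul_sub, norm_mul, norm_sub_rev, mul_comm]
    by_cases hy : φ y = 0
    · simp [hy]
    · gcongr
      refine (norm_sub_taylor_le hf hM x y).trans ?_
      gcongr
      exact norm_le_suppRadius φ hy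
  refine (norm_integral_le_of_norm_le (hφi.const_mul _) (Eventually.of_forall hbd)).trans ?_
  rw [integral_const_mul]
  have hL1 := (hφ hn).2.2.2.2.2.1
  have h2 : 1 + 1 / (n : ℝ) ≤ 2 := by
    have : 1 / (n : ℝ) ≤ 1 := by
      rw [div_le_one (by exact_mod_cast hn)]
      exact_mod_cast hn
    linarith
  have hR := suppRadius_nonneg φ
  calc _ ≤ M * suppRadius φ ^ (n + 1) * 2 := by gcongr; exact hL1.trans h2
    _ = _ := by ring

theorem exists_norm_iteratedFDeriv_le {f : Eucl d → ℂ} (hf : ContDiff ℝ ∞ f)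
    (hs : HasCompactSupport f) (k : ℕ) : ∃ M, ∀ x, ‖iteratedFDeriv ℝ k f x‖ ≤ M := by
  obtain ⟨M, hM⟩ := (hf.continuous_iteratedFDeriv (m := k)
    (by exact_mod_cast le_top)).bounded_above_of_compact_support (hs.iteratedFDeriv k)
  exact ⟨M, hM⟩

end Moments

/-! ### The cut-off functions -/

section Cutoff

variable {d : ℕ} {Ω : Opens (Eucl d)}

theorem DirectingUltrafilter.AE.exists {U : DirectingUltrafilter d} {P : TestFn d → Prop}
    (h : U.AE P) : ∃ φ, P φ := U.toUltrafilter.nonempty_of_mem h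

theorem DirectingUltrafilter.ae_mem (U : DirectingUltrafilter d) (n : ℕ) :
    U.AE (fun φ => φ ∈ directingSet d n) := U.directingSet_mem n

theorem DirectingUltrafilter.ae_radius_le (U : DirectingUltrafilter d) {ε : ℝ} (hε : 0 < ε) :
    U.AE (fun φ => suppRadius φ ≤ ε) := by
  refine (U.ae_radius_mul_le ε⁻¹).mono fun φ h => ?_
  rwa [inv_mul_le_iff₀ hε, mul_one] at h

/-- Near a compact set, points within `R_φ` of it belong to the domain of the cut-off. -/
theorem mem_cutoffDomain {K : Set (Eucl d)} {δ M : ℝ}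
    (hδK : Metric.cthickening δ K ⊆ (Ω : Set (Eucl d))) (hM : ∀ t ∈ K, ‖t‖ ≤ M) (φ : TestFn d)
    (hR0 : 0 < suppRadius φ) (hR1 : suppRadius φ ≤ δ / 4) (hR2 : suppRadius φ ≤ 1)
    (hR3 : (M + 2) * suppRadius φ ≤ 1) {t s : Eucl d} (ht : t ∈ K)
    (hs : dist t s ≤ suppRadius φ) : s ∈ cutoffDomain Ω φ := by
  refine ⟨hδK (Metric.mem_cthickening_of_dist_le s t δ K ht (by rw [dist_comm]; linarith)), ?_, ?_⟩
  · refine lt_of_lt_of_le ((ENNReal.ofReal_lt_ofReal_iff (by linarith)).2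
      (by linarith : 2 * suppRadius φ < 3 * suppRadius φ)) (Metric.le_infEDist.2 fun z hz => ?_)
    have hzΩ : z ∉ (Ω : Set (Eucl d)) := by
      rw [Ω.isOpen.frontier_eq] at hz; exact hz.2
    -- a boundary point has distance more than `δ ≥ 4 R_φ` from `t`, hence at least `3 R_φ` from `s`
    have hzt : δ < dist z t := by
      by_contra! hc
      exact hzΩ (hδK (Metric.mem_cthickening_of_dist_le z t δ K ht hc))
    rw [edist_dist]
    refine ENNReal.ofReal_le_ofReal ?_
    have := dist_triangle_right z t s
    rw [dist_comm z s] at this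
    linarith
  · rw [lt_div_iff₀ hR0]
    have h1 : ‖s‖ ≤ M + suppRadius φ := by
      have := norm_sub_norm_le s t
      rw [← dist_eq_norm, dist_comm] at this
      linarith [hM t ht]
    nlinarith

theorem isCompact_tsupport_cutoff (Ω : Opens (Eucl d)) (φ : TestFn d) :
    IsCompact (tsupport (cutoff Ω φ)) := by
  refine HasCompactSupport.intro (isCompact_closedBall (0 : Eucl d)
    (1 / suppRadius φ + suppRadius φ)) fun t ht => ?_
  refine setIntegral_eq_zero_of_forall_eq_zero fun s hs => ?_
  by_contra hne
  refine ht ?_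
  rw [mem_closedBall_zero_iff]
  have h1 := norm_le_suppRadius φ hne
  have h2 := norm_sub_norm_le t s
  linarith [hs.2.2]

variable [NeZero d]

/-- The cut-off functions are eventually equal to one on each compact subset of `Ω`. -/
theorem ae_cutoff_eq_one (U : DirectingUltrafilter d) {K : Set (Eucl d)} (hK : IsCompact K)
    (hKΩ : K ⊆ (Ω : Set (Eucl d))) : U.AE (fun φ => ∀ t ∈ K, cutoff Ω φ t = 1) := by
  obtain ⟨δ, hδ, hδK⟩ := hK.exists_cthickening_subset_open Ω.isOpen hKΩ
  obtain ⟨M, hM⟩ := hK.isBounded.exists_norm_le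
  refine ((U.ae_mem 1).and ((U.ae_radius_le (by linarith : 0 < δ / 4)).and
    ((U.ae_radius_le one_pos).and (U.ae_radius_mul_le (M + 2))))).mono ?_
  rintro φ ⟨hφ, hR1, hR2, hR3⟩ t ht
  have hR0 := suppRadius_pos φ
  rw [cutoff, setIntegral_eq_integral_of_forall_compl_eq_zero, integral_sub_left_eq_self φ]
  · exact (hφ le_rfl).2.2.2.1
  · intro s hs
    by_contra hne
    refine hs (mem_cutoffDomain hδK hM φ hR0 hR1 hR2 hR3 ht ?_)
    rw [dist_eq_norm]
    exact norm_le_suppRadius φ hne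

/-- Every smooth function on `Ω` agrees near a given compact set with a smooth function on `ℝ^d`
which has compact support in `Ω`. -/
theorem SmoothFn.exists_test_eqOn (U : DirectingUltrafilter d) (f : SmoothFn Ω)
    {K : Set (Eucl d)} (hK : IsCompact K) (hKΩ : K ⊆ (Ω : Set (Eucl d))) :
    ∃ g : 𝓓(Ω, ℂ), ∀ x ∈ K, g x = zeroExt (f : Ω → ℂ) x := by
  obtain ⟨φ, hφ⟩ := (ae_cutoff_eq_one U hK hKΩ).exists
  refine ⟨mkTest (isCompact_tsupport_cutoff Ω φ) (tsupport_cutoff_subset Ω φ)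
    (fun x => cutoff Ω φ x * zeroExt (f : Ω → ℂ) x) ?_ ?_, fun x hx => ?_⟩
  · refine contDiff_iff_contDiffAt.2 fun x => ?_
    by_cases hx : x ∈ tsupport (fun x => cutoff Ω φ x * zeroExt (f : Ω → ℂ) x)
    swap
    · exact contDiffAt_const.congr_of_eventuallyEq (notMem_tsupport_iff_eventuallyEq.1 hx)
    have hx' := tsupport_cutoff_subset Ω φ (tsupport_mul_subset_left hx)
    exact (contDiff_cutoff Ω φ).contDiffAt.mul (SmoothFn.contDiffAt f ⟨x, hx'⟩)
  · intro x hx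
    rw [image_eq_zero_of_notMem_tsupport hx, zero_mul]
  · change cutoff Ω φ x * _ = _
    rw [hφ x hx, one_mul]

end Cutoff

/-! ### Regularizations are moderate nets of smooth functions -/

section Regularization

variable {d : ℕ} {Ω : Opens (Eucl d)}

theorem dirDeriv_mul_sub {g f : Eucl d → ℂ} (hg : ContDiff ℝ ∞ g) (hf : ContDiff ℝ ∞ f)
    (v x t : Eucl d) :
    dirDeriv (v, 0) (fun p : Eucl d × Eucl d => g p.2 * f (p.1 - p.2)) (x, t) =
      g t * dirDeriv v f (x - t) := by
  have h1 : HasFDerivAt (fun p : Eucl d × Eucl d => g p.2) _ (x, t) :=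
    ((hg.differentiable (by simp)).differentiableAt.hasFDerivAt (x := t)).comp
      (x, t) (hasFDerivAt_snd (𝕜 := ℝ) (p := (x, t)))
  have h2 : HasFDerivAt (fun p : Eucl d × Eucl d => f (p.1 - p.2)) _ (x, t) :=
    ((hf.differentiable (by simp)).differentiableAt.hasFDerivAt (x := x - t)).comp
      (x, t) ((hasFDerivAt_fst (𝕜 := ℝ) (p := (x, t))).sub (hasFDerivAt_snd (𝕜 := ℝ) (p := (x, t))))
  rw [dirDeriv, (h1.fun_mul h2).fderiv]
  simp [dirDeriv]

theorem iterDir_comp_sub {f : Eucl d → ℂ} (hf : ContDiff ℝ ∞ f) (x : Eucl d) (l : List (Eucl d)) :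
    iterDir l (fun t => f (x - t)) = fun t => (-1) ^ l.length * iterDir l f (x - t) := by
  induction l with
  | nil => simp
  | cons v l ih =>
    rw [iterDir_cons, ih]
    funext t
    have h1 := ((contDiff_iterDir hf l).differentiable
      (by simp)).differentiableAt.hasFDerivAt (x := x - t)
    have h2 : HasFDerivAt (fun t => (-1) ^ l.length * iterDir l f (x - t)) _ t :=
      (h1.comp t ((hasFDerivAt_id t).const_sub x)).const_mul ((-1 : ℂ) ^ l.length)
    rw [dirDeriv, h2.fderiv]
    simp [dirDeriv, pow_succ]

theorem sub_mem_of_notMem_cthickening {K : Set (Eucl d)} {δ : ℝ} {ψ : TestFn d}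
    (hψ : ∀ y, ψ y ≠ 0 → ‖y‖ ≤ δ) {x : Eucl d} (hx : x ∈ K) {t : Eucl d}
    (ht : t ∉ Metric.cthickening δ K) : ψ (x - t) = 0 := by
  by_contra hne
  refine ht (Metric.mem_cthickening_of_dist_le t x δ K hx ?_)
  rw [dist_comm, dist_eq_norm]
  exact hψ _ hne

theorem norm_le_of_testIter_ne_zero (φ : TestFn d) {δ : ℝ} (hδ : suppRadius φ ≤ δ)
    (l : List (Fin d)) (y : Eucl d) (hy : testIter ⊤ l φ y ≠ 0) : ‖y‖ ≤ δ := by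
  by_contra hc
  rw [coe_testIter] at hy
  refine hy (iterDir_eq_zero_of_eqOn_compl (K := Metric.closedBall 0 δ) Metric.isClosed_closedBall
    (fun z hz => ?_) _ y (by rwa [mem_closedBall_zero_iff]))
  by_contra hne
  exact hz (by rw [mem_closedBall_zero_iff]; exact (norm_le_suppRadius φ hne).trans hδ)

variable [NeZero d]

/-- The test function `t ↦ C_{Ω,φ}(t) ψ(x - t)`. Having `ψ` independent of `φ` makes the family
of these test functions stable under differentiation in `x`. -/
def cutoffWith (Ω : Opens (Eucl d)) (φ ψ : TestFn d) (x : Eucl d) : 𝓓(Ω, ℂ) :=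
  mkTest (isCompact_tsupport_cutoff Ω φ) (tsupport_cutoff_subset Ω φ)
    (fun t => cutoff Ω φ t * ψ (x - t))
    ((contDiff_cutoff Ω φ).mul (ψ.contDiff.comp (contDiff_const.sub contDiff_id)))
    (fun t ht => by rw [image_eq_zero_of_notMem_tsupport ht, zero_mul])

theorem cutoffWith_apply (φ ψ : TestFn d) (x t : Eucl d) :
    cutoffWith Ω φ ψ x t = cutoff Ω φ t * ψ (x - t) := rfl

theorem tsupport_cutoffWith_subset (φ ψ : TestFn d) (x : Eucl d) :
    tsupport (cutoffWith Ω φ ψ x) ⊆ tsupport (cutoff Ω φ) :=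
  tsupport_mul_subset_left

theorem contDiff_cutoff_mul_sub (φ ψ : TestFn d) :
    ContDiff ℝ ∞ (fun p : Eucl d × Eucl d => cutoff Ω φ p.2 * ψ (p.1 - p.2)) :=
  ((contDiff_cutoff Ω φ).comp contDiff_snd).mul (ψ.contDiff.comp (contDiff_fst.sub contDiff_snd))

theorem dirDeriv_cutoff_mul_sub (φ ψ : TestFn d) (v x t : Eucl d) :
    dirDeriv (v, 0) (fun p : Eucl d × Eucl d => cutoff Ω φ p.2 * ψ (p.1 - p.2)) (x, t) =
      cutoff Ω φ t * dirDeriv v ψ (x - t) :=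
  dirDeriv_mul_sub (contDiff_cutoff Ω φ) ψ.contDiff v x t

theorem contDiff_regularization (T : Distr Ω) (φ ψ : TestFn d) :
    ContDiff ℝ ∞ (fun x => T (cutoffWith Ω φ ψ x)) :=
  T.contDiff_family (isCompact_tsupport_cutoff Ω φ) (tsupport_cutoff_subset Ω φ)
    (contDiff_cutoff_mul_sub φ ψ) (fun _ _ => rfl) (tsupport_cutoffWith_subset φ ψ)

/-- The smooth function `x ↦ (T(t) | C_{Ω,φ}(t) ψ(x - t))`. -/
def regFn (T : Distr Ω) (φ ψ : TestFn d) : SmoothFn Ω :=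
  SmoothFn.mk' (fun x => T (cutoffWith Ω φ ψ x)) (contDiff_regularization T φ ψ).contDiffOn

theorem regFn_apply (T : Distr Ω) (φ ψ : TestFn d) (x : Ω) :
    (regFn T φ ψ : Ω → ℂ) x = T (cutoffWith Ω φ ψ x) := rfl

theorem partialDeriv_regFn (T : Distr Ω) (φ ψ : TestFn d) (j : Fin d) :
    SmoothFn.partialDeriv j (regFn T φ ψ) = regFn T φ (testPartial ⊤ j ψ) := by
  ext x
  rw [SmoothFn.partialDeriv_apply,
    (SmoothFn.zeroExt_eventuallyEq (F := fun x => T (cutoffWith Ω φ ψ x))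
      (regFn_apply T φ ψ) x).fderiv_eq, regFn_apply]
  refine T.fderiv_family (isCompact_tsupport_cutoff Ω φ) (tsupport_cutoff_subset Ω φ)
    (contDiff_cutoff_mul_sub φ ψ) (τ' := cutoffWith Ω φ (testPartial ⊤ j ψ))
    (fun _ _ => rfl) (tsupport_cutoffWith_subset φ ψ) (basisVec j) (fun x t => ?_)
    (tsupport_cutoffWith_subset φ _) x
  rw [dirDeriv_cutoff_mul_sub, cutoffWith_apply, coe_testPartial]

theorem deriv_regFn (T : Distr Ω) (φ ψ : TestFn d) (α : Fin d → ℕ) :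
    SmoothFn.deriv α (regFn T φ ψ) = regFn T φ (multiIter (fun i => testPartial ⊤ i) α ψ) := by
  revert ψ
  refine SmoothFn.deriv_induction (P := fun α => ∀ ψ, SmoothFn.deriv α (regFn T φ ψ) =
    regFn T φ (multiIter (fun i => testPartial ⊤ i) α ψ)) (fun ψ => ?_) (fun α j ih ψ => ?_) α
  · rw [SmoothFn.deriv_zero, multiIter_zero]
  · rw [SmoothFn.deriv_add_single, partialDeriv_regFn, ih,
      multiIter_add_single _ (fun i j a => testPartial_comm i j a)]

/-- Where the cut-off is one it can be omitted from the regularization. -/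
theorem coe_cutoffWith {K : Set (Eucl d)} {δ : ℝ} {φ ψ : TestFn d}
    (hC : ∀ t ∈ Metric.cthickening δ K, cutoff Ω φ t = 1) (hψ : ∀ y, ψ y ≠ 0 → ‖y‖ ≤ δ)
    {x : Eucl d} (hx : x ∈ K) : (cutoffWith Ω φ ψ x : Eucl d → ℂ) = fun t => ψ (x - t) := by
  funext t
  rw [cutoffWith_apply]
  by_cases ht : t ∈ Metric.cthickening δ K
  · rw [hC t ht, one_mul]
  · rw [sub_mem_of_notMem_cthickening hψ hx ht, mul_zero]

theorem exists_norm_regFn_le (T : Distr Ω) {K : Set (Eucl d)} (hK : IsCompact K) {δ : ℝ}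
    (hδK : Metric.cthickening δ K ⊆ (Ω : Set (Eucl d))) :
    ∃ (N : ℕ) (C : ℝ), 0 ≤ C ∧ ∀ φ ψ : TestFn d,
      (∀ t ∈ Metric.cthickening δ K, cutoff Ω φ t = 1) → (∀ y, ψ y ≠ 0 → ‖y‖ ≤ δ) →
      ∀ B : ℝ, 0 ≤ B →
      (∀ l : List (Fin d), l.length ≤ N → ∀ y, ‖iterDir (dirs l) ψ y‖ ≤ B) →
      ∀ x : Ω, (x : Eucl d) ∈ K → ‖(regFn T φ ψ : Ω → ℂ) x‖ ≤ C * B := by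
  obtain ⟨N, C, hC0, hC⟩ := T.exists_bound hK.cthickening hδK
  refine ⟨N, C, hC0, fun φ ψ h1 hψ B hB hl x hx => ?_⟩
  have hcoe := coe_cutoffWith h1 hψ hx
  refine hC _ (tsupport_subset_of_eqOn_compl hK.cthickening fun t ht => ?_) B hB
    fun l hlN t _ => ?_
  · rw [hcoe]
    exact sub_mem_of_notMem_cthickening hψ hx ht
  · rw [hcoe, iterDir_comp_sub ψ.contDiff]
    simpa using hl l hlN _

theorem moderate_regFn (U : DirectingUltrafilter d) (T : Distr Ω) :
    (fun φ => regFn T φ φ) ∈ moderateFun U Ω := by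
  intro K hK hKΩ α
  obtain ⟨δ, hδ, hδK⟩ := hK.exists_cthickening_subset_open Ω.isOpen hKΩ
  obtain ⟨N, C, hC0, hC⟩ := exists_norm_regFn_le T hK hδK
  obtain ⟨l₀, hl₀, hl₀α⟩ := exists_testIter_eq_multiIter (Ω := (⊤ : Opens (Eucl d))) α
  -- at most `N + |α|` derivatives fall on `φ`; the `1` only ensures that `n ≥ 1`
  set n := N + absIdx α + 1 with hn
  refine ⟨2 * (n + d) + 1, ((ae_cutoff_eq_one U hK.cthickening hδK).and
    (((U.ae_mem n).and (U.ae_radius_le hδ)).and ((U.ae_radius_mul_le 1).and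
      (U.ae_mul_inv_pow_le C (2 * (n + d)))))).mono ?_⟩
  rintro φ ⟨h1, ⟨hφ, hRδ⟩, hR1, hRC⟩ x hx
  have hR0 := suppRadius_pos φ
  have hR := one_le_inv_suppRadius φ hR1
  simp only [deriv_regFn, hl₀α]
  refine (hC φ _ h1 (norm_le_of_testIter_ne_zero φ hRδ l₀) ((suppRadius φ)⁻¹ ^ (2 * (n + d)))
    (by positivity) (fun l hl y => ?_) x hx).trans hRC
  obtain ⟨β, hβ, hβl⟩ := exists_multiIter_eq_testIter (Ω := (⊤ : Opens (Eucl d))) (l ++ l₀)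
  have h2 : iterDir (dirs l) (testIter ⊤ l₀ φ) = testIter ⊤ (l ++ l₀) φ := by
    rw [← coe_testIter, testIter, testIter, testIter, List.foldr_append]
  have hβn : absIdx β ≤ n := by
    rw [hβ, List.length_append]; omega
  rw [h2, hβl]
  refine ((hφ (by omega)).2.2.2.2.2.2 β hβn y).trans ?_
  gcongr

/-- The net `(T ⊛ φ)`. -/
def regNet (U : DirectingUltrafilter d) (T : Distr Ω) : moderateFun U Ω :=
  ⟨fun φ => regFn T φ φ, moderate_regFn U T⟩

theorem regFn_eq_regularize (T : Distr Ω) (φ : TestFn d) (x : Ω) :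
    (regFn T φ φ : Ω → ℂ) x = regularize T φ x := rfl

theorem distEmb_eq_mk (U : DirectingUltrafilter d) (T : Distr Ω) :
    distEmb U T = AsympFun.mk (regNet U T) := by
  have h : ∃ F : moderateFun U Ω, ∀ (φ : TestFn d) (x : Ω),
      (((F : TestFn d → SmoothFn Ω) φ : SmoothFn Ω) : Ω → ℂ) x = regularize T φ x :=
    ⟨regNet U T, fun φ x => rfl⟩
  rw [distEmb, dif_pos h]
  congr 1
  refine Subtype.ext (funext fun φ => ?_)
  ext x
  rw [h.choose_spec φ x]
  rfl

end Regularization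

/-! ### Equality of asymptotic functions -/

section Equality

theorem map_multiIter {d : ℕ} {A B : Type*} {D : Fin d → A → A} {D' : Fin d → B → B} {g : A → B}
    (h : ∀ i a, g (D i a) = D' i (g a)) (α : Fin d → ℕ) (a : A) :
    g (multiIter D α a) = multiIter D' α (g a) := by
  unfold multiIter
  induction List.finRange d with
  | nil => rfl
  | cons i l ih =>
    rw [List.foldr_cons, List.foldr_cons, ← ih]
    exact (Function.Semiconj.iterate_right (f := g) (h i) (α i)) _

variable {d : ℕ} {Ω O : Opens (Eucl d)}

theorem SmoothFn.deriv_eq_zero_of_eqOn {V : Set (Eucl d)} (hV : IsOpen V) (h : SmoothFn Ω)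
    (h0 : ∀ x : Ω, (x : Eucl d) ∈ V → (h : Ω → ℂ) x = 0) (α : Fin d → ℕ) :
    ∀ x : Ω, (x : Eucl d) ∈ V → (SmoothFn.deriv α h : Ω → ℂ) x = 0 := by
  revert h
  refine SmoothFn.deriv_induction (P := fun α => ∀ h : SmoothFn Ω,
    (∀ x : Ω, (x : Eucl d) ∈ V → (h : Ω → ℂ) x = 0) →
    ∀ x : Ω, (x : Eucl d) ∈ V → (SmoothFn.deriv α h : Ω → ℂ) x = 0) ?_ ?_ α
  · intro h h0
    rwa [SmoothFn.deriv_zero]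
  · intro α j ih h h0
    rw [SmoothFn.deriv_add_single]
    refine ih _ fun x hx => ?_
    have : zeroExt (h : Ω → ℂ) =ᶠ[𝓝 (x : Eucl d)] fun _ => 0 := by
      filter_upwards [hV.mem_nhds hx, Ω.isOpen.mem_nhds x.2] with y hy hyΩ
      rw [zeroExt_of_mem _ hyΩ, h0 ⟨y, hyΩ⟩ hy]
    rw [SmoothFn.partialDeriv_apply, this.fderiv_eq]
    simp

variable [NeZero d] {U : DirectingUltrafilter d}

/-- Nets which are almost everywhere equal on each compact set represent the same asymptotic
function. -/
theorem AsympFun.mk_eq_mk_of_ae_eqOn {F G : moderateFun U Ω}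
    (h : ∀ K : Set (Eucl d), IsCompact K → K ⊆ (Ω : Set (Eucl d)) →
      U.AE (fun φ => ∀ x : Ω, (x : Eucl d) ∈ K →
        ((F : TestFn d → SmoothFn Ω) φ : Ω → ℂ) x = ((G : TestFn d → SmoothFn Ω) φ : Ω → ℂ) x)) :
    (AsympFun.mk F : AsympFun U Ω) = AsympFun.mk G := by
  rw [← sub_eq_zero, ← map_sub, AsympFun.mk_eq_zero]
  intro K hK hKΩ α p
  obtain ⟨δ, hδ, hδK⟩ := hK.exists_cthickening_subset_open Ω.isOpen hKΩ
  refine (h _ hK.cthickening hδK).mono fun φ hφ x hx => ?_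
  have h0 := SmoothFn.deriv_eq_zero_of_eqOn (Metric.isOpen_thickening (δ := δ) (E := K))
    ((F : TestFn d → SmoothFn Ω) φ - (G : TestFn d → SmoothFn Ω) φ)
    (fun y hy => sub_eq_zero.2 (hφ y (Metric.thickening_subset_cthickening δ K hy))) α x
    (Metric.self_subset_thickening hδ K hx)
  change ‖(SmoothFn.deriv α ((F : TestFn d → SmoothFn Ω) φ -
    (G : TestFn d → SmoothFn Ω) φ) : Ω → ℂ) x‖ ≤ _
  rw [h0, norm_zero]
  exact pow_nonneg (suppRadius_pos φ).le p

/-- The cut-off disappears, and the support of `φ` is small, near each compact set. -/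
theorem ae_cutoff_eq_one_and_radius_le (U : DirectingUltrafilter d) {K : Set (Eucl d)}
    (hK : IsCompact K) {δ : ℝ} (hδ : 0 < δ) (hδK : Metric.cthickening δ K ⊆ (Ω : Set (Eucl d))) :
    U.AE (fun φ => (∀ t ∈ Metric.cthickening δ K, cutoff Ω φ t = 1) ∧
      ∀ y, φ y ≠ 0 → ‖y‖ ≤ δ) :=
  ((ae_cutoff_eq_one U hK.cthickening hδK).and (U.ae_radius_le hδ)).mono fun φ h =>
    ⟨h.1, fun _ hy => (norm_le_suppRadius φ hy).trans h.2⟩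

end Equality

/-! ### Linearity, derivatives and restrictions of the distributional embedding -/

section Embedding

variable {d : ℕ} [NeZero d] {Ω O : Opens (Eucl d)} (U : DirectingUltrafilter d)

theorem isLinearMap_distEmb : IsLinearMap ℂ (fun T : Distr Ω => distEmb U T) where
  map_add S T := by
    simp only [distEmb_eq_mk, ← map_add]
    rfl
  map_smul c T := by
    simp only [distEmb_eq_mk, ← map_smul]
    rfl

theorem distEmb_partialDeriv (j : Fin d) (T : Distr Ω) :
    distEmb U (Distr.partialDeriv j T) = AsympFun.partialDeriv j (distEmb U T) := by
  rw [distEmb_eq_mk, distEmb_eq_mk, AsympFun.partialDeriv_mk]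
  refine AsympFun.mk_eq_mk_of_ae_eqOn fun K hK hKΩ => ?_
  obtain ⟨δ, hδ, hδK⟩ := hK.exists_cthickening_subset_open Ω.isOpen hKΩ
  refine ((ae_cutoff_eq_one U hK.cthickening hδK).and (U.ae_radius_le hδ)).mono ?_
  rintro φ ⟨hC, hR⟩ x hx
  have hφ : ∀ y, φ y ≠ 0 → ‖y‖ ≤ δ := fun y hy => (norm_le_suppRadius φ hy).trans hR
  have h1 : testPartial Ω j (cutoffWith Ω φ φ x) = -cutoffWith Ω φ (testPartial ⊤ j φ) x := by
    refine DFunLike.coe_injective ?_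
    funext t
    change _ = -(cutoffWith Ω φ (testPartial ⊤ j φ) x : Eucl d → ℂ) t
    rw [coe_testPartial, coe_cutoffWith hC hφ hx, coe_cutoffWith (ψ := testPartial ⊤ j φ) hC
      (norm_le_of_testIter_ne_zero φ hR [j]) hx, coe_testPartial]
    have := congrFun (iterDir_comp_sub φ.contDiff (x : Eucl d) [basisVec j]) t
    simpa using this
  change (regFn (Distr.partialDeriv j T) φ φ : Ω → ℂ) x =
    (SmoothFn.partialDeriv j (regFn T φ φ) : Ω → ℂ) x
  rw [partialDeriv_regFn, regFn_apply, regFn_apply]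
  change -(T (testPartial Ω j (cutoffWith Ω φ φ x))) = _
  rw [h1, map_neg, neg_neg]

theorem distEmb_deriv (α : Fin d → ℕ) (T : Distr Ω) :
    distEmb U (Distr.deriv α T) = AsympFun.deriv α (distEmb U T) :=
  map_multiIter (fun j T => distEmb_partialDeriv U j T) α T

theorem restrict_distEmb (hO : O ≤ Ω) (T : Distr Ω) :
    AsympFun.restrict hO (distEmb U T) = distEmb U (Distr.restrict hO T) := by
  rw [distEmb_eq_mk, distEmb_eq_mk, AsympFun.restrict_mk]
  refine AsympFun.mk_eq_mk_of_ae_eqOn fun K hK hKO => ?_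
  obtain ⟨δ, hδ, hδK⟩ := hK.exists_cthickening_subset_open O.isOpen hKO
  refine ((ae_cutoff_eq_one_and_radius_le U hK hδ hδK).and
    (ae_cutoff_eq_one_and_radius_le U hK hδ (hδK.trans hO))).mono ?_
  rintro φ ⟨⟨hC, hφ⟩, hC', -⟩ x hx
  change T (cutoffWith Ω φ φ x) = T (TestFunction.monoCLM ℂ (cutoffWith O φ φ x))
  congr 1
  refine DFunLike.coe_injective ?_
  rw [coe_cutoffWith hC' hφ hx]
  funext t
  rw [TestFunction.monoCLM_apply, if_pos ⟨le_rfl, hO⟩, coe_cutoffWith hC hφ hx]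

end Embedding

/-! ### The Schwartz embedding -/

section Schwartz

variable {d : ℕ} {Ω O : Opens (Eucl d)}

theorem LocInt.integrable_mul (f : LocInt Ω) (τ : 𝓓(Ω, ℂ)) :
    Integrable (fun x => (f : Eucl d →ₘ[volume.restrict (Ω : Set (Eucl d))] ℂ) x * τ x)
      (volume.restrict (Ω : Set (Eucl d))) := by
  have := TestFunction.integrable_bilin (ContinuousLinearMap.mul ℂ ℂ)
    (LocInt.locallyIntegrableOn f) τ
  simpa only [ContinuousLinearMap.mul_apply', mul_comm] using this.restrict

theorem isLinearMap_schwartzEmb : IsLinearMap ℂ (schwartzEmb : LocInt Ω → Distr Ω) where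
  map_add f g := by
    ext τ
    change schwartzEmb (f + g) τ = schwartzEmb f τ + schwartzEmb g τ
    rw [schwartzEmb_apply, schwartzEmb_apply, schwartzEmb_apply,
      ← integral_add (LocInt.integrable_mul f τ) (LocInt.integrable_mul g τ)]
    refine integral_congr_ae ?_
    filter_upwards [AEEqFun.coeFn_add (f : Eucl d →ₘ[volume.restrict (Ω : Set (Eucl d))] ℂ) g]
      with x hx
    rw [Submodule.coe_add, hx, Pi.add_apply, add_mul]
  map_smul c f := by
    ext τ
    change schwartzEmb (c • f) τ = c * schwartzEmb f τ
    rw [schwartzEmb_apply, schwartzEmb_apply, ← integral_const_mul]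
    refine integral_congr_ae ?_
    filter_upwards [AEEqFun.coeFn_smul c (f : Eucl d →ₘ[volume.restrict (Ω : Set (Eucl d))] ℂ)]
      with x hx
    rw [Submodule.coe_smul, hx, Pi.smul_apply, smul_eq_mul, mul_assoc]

theorem schwartzEmb_injective : Function.Injective (schwartzEmb : LocInt Ω → Distr Ω) := by
  intro f g hfg
  rw [← sub_eq_zero]
  have h0 : schwartzEmb (f - g) = 0 := by
    have := (IsLinearMap.mk' schwartzEmb (isLinearMap_schwartzEmb (Ω := Ω))).map_sub f g
    exact this.trans (sub_eq_zero.2 hfg)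
  set h := f - g with hh
  have hae := Ω.isOpen.ae_eq_zero_of_integral_contDiff_smul_eq_zero
    (LocInt.locallyIntegrableOn h) (fun ρ hρ hρc hρΩ => by
      let τ : 𝓓(Ω, ℂ) := mkTest (Ω := Ω) hρc hρΩ (fun x => (ρ x : ℂ))
        (Complex.ofRealCLM.contDiff.comp hρ)
        (fun x hx => by rw [image_eq_zero_of_notMem_tsupport hx, Complex.ofReal_zero])
      have h1 : schwartzEmb h τ = 0 := by rw [h0]; rfl
      rw [schwartzEmb_apply, setIntegral_eq_integral_of_forall_compl_eq_zero] at h1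
      · rw [← h1]
        refine integral_congr_ae (Eventually.of_forall fun x => ?_)
        change ρ x • _ = _ * (ρ x : ℂ)
        rw [Complex.real_smul, mul_comm]
      · intro x hx
        rw [image_eq_zero_of_notMem_tsupport (fun hc => hx (τ.tsupport_subset hc)), mul_zero])
  refine Subtype.ext (AEEqFun.ext ?_)
  refine EventuallyEq.trans ?_ AEEqFun.coeFn_zero.symm
  exact (ae_restrict_iff' Ω.isOpen.measurableSet).2 hae

theorem schwartzEmb_restrict (hO : O ≤ Ω) (f : LocInt Ω) :
    schwartzEmb (LocInt.restrict hO f) = Distr.restrict hO (schwartzEmb f) := by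
  ext τ
  change _ = schwartzEmb f (TestFunction.monoCLM ℂ τ)
  have hmono : ∀ x, (TestFunction.monoCLM ℂ τ : 𝓓(Ω, ℂ)) x = τ x := fun x => by
    rw [TestFunction.monoCLM_apply, if_pos ⟨le_rfl, hO⟩]
  rw [schwartzEmb_apply, schwartzEmb_apply,
    setIntegral_eq_of_subset_of_forall_sdiff_eq_zero Ω.isOpen.measurableSet hO]
  · refine integral_congr_ae ?_
    have h1 : ((LocInt.restrict hO f : LocInt O) :
        Eucl d →ₘ[volume.restrict (O : Set (Eucl d))] ℂ) =ᵐ[volume.restrict (O : Set (Eucl d))]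
        (f : Eucl d →ₘ[volume.restrict (Ω : Set (Eucl d))] ℂ) := AEEqFun.coeFn_mk _ _
    filter_upwards [h1] with x hx
    rw [hx, hmono]
  · intro x hx
    rw [hmono, image_eq_zero_of_notMem_tsupport (fun hc => hx.2 (τ.tsupport_subset hc)), mul_zero]

theorem schwartzEmb_toLocInt_apply (f : SmoothFn Ω) (τ : 𝓓(Ω, ℂ)) :
    schwartzEmb (SmoothFn.toLocInt f) τ =
      ∫ x in (Ω : Set (Eucl d)), zeroExt (f : Ω → ℂ) x * τ x := by
  rw [schwartzEmb_apply]
  refine integral_congr_ae ?_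
  have h1 : ((SmoothFn.toLocInt f : LocInt Ω) :
      Eucl d →ₘ[volume.restrict (Ω : Set (Eucl d))] ℂ) =ᵐ[volume.restrict (Ω : Set (Eucl d))]
      zeroExt (f : Ω → ℂ) := AEEqFun.coeFn_mk _ _
  filter_upwards [h1] with x hx
  rw [hx]

theorem setIntegral_mul_test (f : Eucl d → ℂ) (τ : 𝓓(Ω, ℂ)) :
    ∫ x in (Ω : Set (Eucl d)), f x * τ x = ∫ x, f x * τ x :=
  setIntegral_eq_integral_of_forall_compl_eq_zero fun x hx => by
    rw [image_eq_zero_of_notMem_tsupport (fun hc => hx (τ.tsupport_subset hc)), mul_zero]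

/-- Integration by parts: the Schwartz embedding commutes with partial derivatives. -/
theorem partialDeriv_schwartzEmb (j : Fin d) (f : SmoothFn Ω) :
    Distr.partialDeriv j (schwartzEmb (SmoothFn.toLocInt f)) =
      schwartzEmb (SmoothFn.toLocInt (SmoothFn.partialDeriv j f)) := by
  ext τ
  change -(schwartzEmb (SmoothFn.toLocInt f) (testPartial Ω j τ)) = _
  rw [schwartzEmb_toLocInt_apply, schwartzEmb_toLocInt_apply, setIntegral_mul_test,
    setIntegral_mul_test, coe_testPartial]
  have hfd : ∀ x, zeroExt (SmoothFn.partialDeriv j f : Ω → ℂ) x * τ x =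
      fderiv ℝ (zeroExt (f : Ω → ℂ)) x (basisVec j) * τ x := by
    intro x
    by_cases hx : x ∈ tsupport τ
    · rw [zeroExt_of_mem _ (τ.tsupport_subset hx), SmoothFn.partialDeriv_apply]
    · rw [image_eq_zero_of_notMem_tsupport hx, mul_zero, mul_zero]
  have hint : ∀ (f : SmoothFn Ω) (τ : 𝓓(Ω, ℂ)),
      Integrable (fun x => zeroExt (f : Ω → ℂ) x * τ x) := fun f τ => by
    have h1 := TestFunction.integrable_bilin (ContinuousLinearMap.mul ℂ ℂ) (μ := volume)
      ((SmoothFn.continuousOn f).locallyIntegrableOn Ω.isOpen.measurableSet) τ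
    simpa only [ContinuousLinearMap.mul_apply', mul_comm] using h1
  have hparts := integral_mul_fderiv_eq_neg_fderiv_mul_of_integrable (μ := volume)
    (f := zeroExt (f : Ω → ℂ)) (g := τ) (v := basisVec j)
    (by simpa only [hfd] using hint (SmoothFn.partialDeriv j f) τ)
    (by simpa only [coe_testPartial, dirDeriv] using hint f (testPartial Ω j τ)) (hint f τ)
    (fun x hx => SmoothFn.differentiableAt f ⟨x, τ.tsupport_subset hx⟩)
    (fun x _ => (τ.contDiff.differentiable (by simp)).differentiableAt)
  simp only [hfd]
  change -(∫ x, zeroExt (f : Ω → ℂ) x * fderiv ℝ τ x (basisVec j)) = _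
  rw [hparts, neg_neg]

end Schwartz

/-! ### Smooth functions are reproduced by the embedding -/

section Consistency

variable {d : ℕ} {Ω : Opens (Eucl d)}

theorem integral_comp_sub_mul_eq_average {φ : TestFn d} (hφ : ∀ x, φ (-x) = φ x)
    (g : Eucl d → ℂ) (x : Eucl d) : ∫ t, g t * φ (x - t) = ∫ y, φ y * g (x + y) := by
  have h1 := integral_sub_left_eq_self (fun y => φ y * g (x - y)) volume x
  have h2 := integral_neg_eq_self (fun y => φ y * g (x - y)) volume
  rw [← sub_eq_zero]
  simp only [sub_sub_cancel, hφ, sub_neg_eq_add] at h1 h2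
  rw [sub_eq_zero, h2, ← h1]
  simp only [mul_comm]

variable [NeZero d] (U : DirectingUltrafilter d)

/-- The regularization of a smooth function differs from it by a negligible amount; derivatives
are not yet taken into account. -/
theorem negligibleOn_regFn_sub (f : SmoothFn Ω) {K : Set (Eucl d)} (hK : IsCompact K)
    (hKΩ : K ⊆ (Ω : Set (Eucl d))) :
    NegligibleOn U K (fun φ => regFn (schwartzEmb (SmoothFn.toLocInt f)) φ φ - f) := by
  intro p
  obtain ⟨δ, hδ, hδK⟩ := hK.exists_cthickening_subset_open Ω.isOpen hKΩ
  obtain ⟨g, hg⟩ := SmoothFn.exists_test_eqOn U f hK.cthickening hδK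
  obtain ⟨M, hM⟩ := exists_norm_iteratedFDeriv_le g.contDiff g.hasCompactSupport (p + 1 + 1)
  refine ((ae_cutoff_eq_one_and_radius_le U hK hδ hδK).and (((U.ae_mem (p + 1)).and
    (U.ae_radius_le one_pos)).and (U.ae_mul_pow_lt (2 * M) (p + 1)))).mono ?_
  rintro φ ⟨⟨hC, hφδ⟩, ⟨hφ, hR1⟩, hRM⟩ x hx
  have hR0 := suppRadius_pos φ
  have hreg : (regFn (schwartzEmb (SmoothFn.toLocInt f)) φ φ : Ω → ℂ) x =
      ∫ y, φ y * g (x + y) := by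
    rw [regFn_apply, schwartzEmb_toLocInt_apply, setIntegral_mul_test,
      ← integral_comp_sub_mul_eq_average (hφ (by omega)).2.1, coe_cutoffWith hC hφδ hx]
    refine integral_congr_ae (Eventually.of_forall fun t => ?_)
    change zeroExt (f : Ω → ℂ) t * φ (x - t) = g t * φ (x - t)
    by_cases ht : t ∈ Metric.cthickening δ K
    · rw [hg t ht]
    · rw [sub_mem_of_notMem_cthickening hφδ hx ht, mul_zero, mul_zero]
  have hgx : (f : Ω → ℂ) x = g x := by
    rw [hg x (Metric.self_subset_cthickening K hx), zeroExt_apply]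
  change ‖(regFn (schwartzEmb (SmoothFn.toLocInt f)) φ φ : Ω → ℂ) x - (f : Ω → ℂ) x‖ ≤ _
  rw [hreg, hgx, norm_sub_rev]
  refine (norm_average_sub_le (by omega) hφ g.contDiff hM x).trans (hRM.le.trans ?_)
  exact pow_le_pow_of_le_one hR0.le hR1 (Nat.le_succ p)

/-- The embedding of distributions extends the standard embedding of smooth functions. -/
theorem locEmb_toLocInt (f : SmoothFn Ω) : locEmb U (SmoothFn.toLocInt f) = stdEmb U Ω f := by
  have key : ∀ (K : Set (Eucl d)), IsCompact K → K ⊆ (Ω : Set (Eucl d)) → ∀ (α : Fin d → ℕ)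
      (f : SmoothFn Ω), NegligibleOn U K
        (fun φ => SmoothFn.deriv α (regFn (schwartzEmb (SmoothFn.toLocInt f)) φ φ - f)) := by
    intro K hK hKΩ α
    refine SmoothFn.deriv_induction (P := fun α => ∀ f : SmoothFn Ω, NegligibleOn U K
        (fun φ => SmoothFn.deriv α (regFn (schwartzEmb (SmoothFn.toLocInt f)) φ φ - f)))
      (fun f => ?_) (fun α j ih f => ?_) α
    · simpa only [SmoothFn.deriv_zero] using negligibleOn_regFn_sub U f hK hKΩ
    -- regularization and `∂_j` commute up to a negligible net
    have h1 : netPartial j (regNet U (schwartzEmb (SmoothFn.toLocInt f))) -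
        regNet U (schwartzEmb (SmoothFn.toLocInt (SmoothFn.partialDeriv j f))) ∈
        negligibleFun U Ω := by
      rw [← AsympFun.mk_eq_zero, map_sub, sub_eq_zero, ← AsympFun.partialDeriv_mk,
        ← distEmb_eq_mk, ← distEmb_eq_mk, ← distEmb_partialDeriv, partialDeriv_schwartzEmb]
    have h2 : ∀ φ, SmoothFn.deriv (bumpIdx α j)
        (regFn (schwartzEmb (SmoothFn.toLocInt f)) φ φ - f) =
        SmoothFn.deriv α (SmoothFn.partialDeriv j
          (regFn (schwartzEmb (SmoothFn.toLocInt f)) φ φ) -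
          regFn (schwartzEmb (SmoothFn.toLocInt (SmoothFn.partialDeriv j f))) φ φ) +
        SmoothFn.deriv α (regFn (schwartzEmb (SmoothFn.toLocInt (SmoothFn.partialDeriv j f))) φ φ -
          SmoothFn.partialDeriv j f) := by
      intro φ
      rw [← SmoothFn.deriv_add, SmoothFn.deriv_add_single, map_sub, sub_add_sub_cancel]
    simp only [h2]
    exact NegligibleOn.add (h1 K hK hKΩ α) (ih (SmoothFn.partialDeriv j f))
  rw [locEmb, distEmb_eq_mk, stdEmb, AlgHom.comp_apply, ← sub_eq_zero, ← map_sub,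
    AsympFun.mk_eq_zero]
  exact fun K hK hKΩ α => key K hK hKΩ α f

end Consistency

/-! ### The pairing with test functions -/

section Pairing

variable {d : ℕ} {Ω : Opens (Eucl d)}

theorem contDiff_mul_comp_add {φ f : Eucl d → ℂ} (hφ : ContDiff ℝ ∞ φ) (hf : ContDiff ℝ ∞ f) :
    ContDiff ℝ ∞ (fun p : Eucl d × Eucl d => φ p.1 * f (p.2 + p.1)) :=
  (hφ.comp contDiff_fst).mul (hf.comp (contDiff_snd.add contDiff_fst))

theorem iterDir_const_mul_comp_add {f : Eucl d → ℂ} (hf : ContDiff ℝ ∞ f) (c : ℂ) (y : Eucl d)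
    (l : List (Eucl d)) :
    iterDir l (fun t => c * f (t + y)) = fun t => c * iterDir l f (t + y) := by
  induction l with
  | nil => rfl
  | cons v l ih =>
    rw [iterDir_cons, ih]
    funext t
    have h1 := ((contDiff_iterDir hf l).differentiable
      (by simp)).differentiableAt.hasFDerivAt (x := t + y)
    have h2 : HasFDerivAt (fun t => c * iterDir l f (t + y)) _ t :=
      (h1.comp t ((hasFDerivAt_id t).add_const y)).const_mul c
    rw [dirDeriv, h2.fderiv]
    simp [dirDeriv]

/-- Averages commute with derivatives. -/
theorem iterDir_average (φ : TestFn d) {f : Eucl d → ℂ} (hf : ContDiff ℝ ∞ f)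
    (l : List (Eucl d)) :
    iterDir l (fun t => ∫ y, φ y * f (t + y)) = fun t => ∫ y, φ y * iterDir l f (t + y) := by
  have hH := contDiff_mul_comp_add φ.contDiff hf
  rw [iterDir_integral_family hH φ.hasCompactSupport (fun x hx t => by
    simp [image_eq_zero_of_notMem_tsupport hx])]
  funext t
  refine integral_congr_ae (Eventually.of_forall fun y => ?_)
  have h1 := congrFun (iterDir_slice hH l y) t
  exact h1.symm.trans (congrFun (iterDir_const_mul_comp_add hf (φ y) y l) t)

theorem contDiff_average (φ : TestFn d) {f : Eucl d → ℂ} (hf : ContDiff ℝ ∞ f) :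
    ContDiff ℝ ∞ (fun t => ∫ y, φ y * f (t + y)) :=
  contDiff_integral_family (contDiff_mul_comp_add φ.contDiff hf) φ.hasCompactSupport
    (fun x hx t => by simp [image_eq_zero_of_notMem_tsupport hx])

variable [NeZero d]

/-- Pairing a regularization with a test function amounts to applying the distribution to an
average of the test function. -/
theorem exists_smoothPairing_regFn (T : Distr Ω) {φ : TestFn d} (hφ : ∀ x, φ (-x) = φ x)
    (τ : 𝓓(Ω, ℂ)) : ∃ σ : 𝓓(Ω, ℂ),
      (∀ t, σ t = cutoff Ω φ t * ∫ y, φ y * τ (t + y)) ∧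
      smoothPairing (regFn T φ φ) τ = T σ := by
  have hcpt := isCompact_tsupport_cutoff Ω φ
  have hsub := tsupport_cutoff_subset Ω φ
  -- Fubini's theorem is applied to the family `x ↦ τ(x) C_{Ω,φ}(t) φ(x - t)`
  let H : Eucl d × Eucl d → ℂ := fun p => τ p.1 * (cutoff Ω φ p.2 * φ (p.1 - p.2))
  have hH : ContDiff ℝ ∞ H := (τ.contDiff.comp contDiff_fst).mul (contDiff_cutoff_mul_sub φ φ)
  let σ : 𝓓(Ω, ℂ) := mkTest hcpt hsub (fun t => cutoff Ω φ t * ∫ y, φ y * τ (t + y))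
    ((contDiff_cutoff Ω φ).mul (contDiff_average φ τ.contDiff))
    (fun t ht => by rw [image_eq_zero_of_notMem_tsupport ht, zero_mul])
  have hflip : ∀ x t, φ (x - t) = φ (t - x) := fun x t => by rw [← hφ, neg_sub]
  refine ⟨σ, fun _ => rfl, ?_⟩
  rw [smoothPairing, setIntegral_mul_test]
  have h := T.integral_family hcpt hsub τ.hasCompactSupport hH
    (fun x hx t => by simp [H, image_eq_zero_of_notMem_tsupport hx])
    (τ := fun x => τ x • cutoffWith Ω φ φ x) (fun _ _ => rfl)
    (fun x => tsupport_subset_of_eqOn_compl hcpt fun t ht => by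
      change τ x * (cutoff Ω φ t * φ (x - t)) = 0
      rw [image_eq_zero_of_notMem_tsupport ht, zero_mul, mul_zero])
    (σ := σ) (fun t => by
      change cutoff Ω φ t * ∫ y, φ y * τ (t + y) = ∫ x, τ x * (cutoff Ω φ t * φ (x - t))
      rw [← integral_comp_sub_mul_eq_average hφ, ← integral_const_mul]
      refine integral_congr_ae (Eventually.of_forall fun x => ?_)
      change cutoff Ω φ t * (τ x * φ (t - x)) = τ x * (cutoff Ω φ t * φ (x - t))
      rw [hflip x t]
      ring)
    (tsupport_subset_of_eqOn_compl hcpt fun t ht => by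
      change cutoff Ω φ t * _ = 0
      rw [image_eq_zero_of_notMem_tsupport ht, zero_mul])
  rw [h]
  refine integral_congr_ae (Eventually.of_forall fun x => ?_)
  change zeroExt (regFn T φ φ : Ω → ℂ) x * τ x = T (τ x • cutoffWith Ω φ φ x)
  rw [map_smul, smul_eq_mul, mul_comm]
  by_cases hx : x ∈ tsupport τ
  · rw [zeroExt_of_mem _ (τ.tsupport_subset hx), regFn_apply]
  · rw [image_eq_zero_of_notMem_tsupport hx, zero_mul, zero_mul]

variable (U : DirectingUltrafilter d)

theorem pairing_distEmb (T : Distr Ω) (τ : 𝓓(Ω, ℂ)) :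
    algebraMap ℂ (AsympNum U) (T τ) = AsympFun.pairing τ (distEmb U T) := by
  rw [distEmb_eq_mk, AsympFun.pairing_mk, AsympNum.algebraMap_eq, ← sub_eq_zero, ← map_sub,
    AsympNum.mk_eq_zero]
  intro p
  change U.AE (fun φ => ‖T τ - smoothPairing (regFn T φ φ) τ‖ < suppRadius φ ^ p)
  have hK : IsCompact (tsupport τ) := τ.hasCompactSupport
  obtain ⟨δ, hδ, hδK⟩ := hK.exists_cthickening_subset_open Ω.isOpen τ.tsupport_subset
  obtain ⟨N, C, hC0, hT⟩ := T.exists_bound hK.cthickening hδK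
  -- a common bound for the derivatives occurring in the Taylor remainders
  choose M hM using fun l : ShortList d N => exists_norm_iteratedFDeriv_le
    (testIter Ω l.1 τ).contDiff (testIter Ω l.1 τ).hasCompactSupport (p + 1 + 1)
  have hM0 : ∀ l, 0 ≤ M l := fun l => (norm_nonneg _).trans (hM l 0)
  refine ((ae_cutoff_eq_one_and_radius_le U hK hδ hδK).and (((U.ae_mem (p + 1)).and
    (U.ae_radius_le one_pos)).and (U.ae_mul_pow_lt (C * (2 * ∑ l, M l)) (p + 1)))).mono ?_
  rintro φ ⟨⟨hC, hφδ⟩, ⟨hφ, hR1⟩, hRM⟩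
  have hR0 := suppRadius_pos φ
  obtain ⟨σ, hσ, hpair⟩ := exists_smoothPairing_regFn T (hφ (by omega)).2.1 τ
  -- the average of `τ` lives near the support of `τ`, so the cut-off does not affect it
  have hoff : ∀ t ∉ Metric.cthickening δ (tsupport τ), ∫ y, φ y * τ (t + y) = 0 := by
    intro t ht
    rw [← integral_comp_sub_mul_eq_average (hφ (by omega)).2.1]
    refine integral_eq_zero_of_ae (Eventually.of_forall fun x => ?_)
    change τ x * φ (t - x) = 0
    by_cases hx : x ∈ tsupport τ
    · have h1 := sub_mem_of_notMem_cthickening hφδ hx ht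
      rw [← (hφ (by omega)).2.1, neg_sub, h1, mul_zero]
    · rw [image_eq_zero_of_notMem_tsupport hx, zero_mul]
  have hcoe : ((τ - σ : 𝓓(Ω, ℂ)) : Eucl d → ℂ) = fun t => τ t - ∫ y, φ y * τ (t + y) := by
    funext t
    change τ t - σ t = _
    rw [hσ]
    by_cases ht : t ∈ Metric.cthickening δ (tsupport τ)
    · rw [hC t ht, one_mul]
    · rw [hoff t ht, mul_zero]
  rw [hpair, ← map_sub]
  refine (hT (τ - σ) (tsupport_subset_of_eqOn_compl hK.cthickening fun t ht => ?_)
    (2 * (∑ l, M l) * suppRadius φ ^ (p + 1 + 1))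
    (by have := Finset.sum_nonneg fun l (_ : l ∈ Finset.univ) => hM0 l; positivity)
    fun l hl t _ => ?_).trans_lt ?_
  · rw [hcoe]
    change τ t - _ = 0
    rw [hoff t ht, sub_zero]
    exact image_eq_zero_of_notMem_tsupport fun h => ht (Metric.self_subset_cthickening _ h)
  · rw [hcoe, iterDir_sub τ.contDiff (contDiff_average φ τ.contDiff), iterDir_average φ τ.contDiff,
      ← coe_testIter]
    refine (norm_average_sub_le (by omega) hφ (testIter Ω l τ).contDiff (hM ⟨l, hl⟩) t).trans ?_
    gcongr
    exact Finset.single_le_sum (f := M) (fun l _ => hM0 l)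
      (Finset.mem_univ (⟨l, hl⟩ : ShortList d N))
  · calc _ = C * (2 * ∑ l, M l) * suppRadius φ ^ (p + 1 + 1) := by ring
      _ < suppRadius φ ^ (p + 1) := hRM
      _ ≤ _ := pow_le_pow_of_le_one hR0.le hR1 (Nat.le_succ p)

end Pairing

/-! ### Injectivity -/

section Injectivity

variable {d : ℕ} {Ω : Opens (Eucl d)} (U : DirectingUltrafilter d)

theorem eq_zero_of_ae_norm_le {c : ℂ} (h : U.AE (fun φ => ‖c‖ ≤ suppRadius φ)) : c = 0 := by
  by_contra hc
  have hc' : 0 < ‖c‖ / 2 := by positivity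
  obtain ⟨φ, h1, h2⟩ := (h.and (U.ae_radius_le hc')).exists
  linarith

variable [NeZero d]

theorem algebraMap_asympNum_injective : Function.Injective (algebraMap ℂ (AsympNum U)) := by
  rw [injective_iff_map_eq_zero]
  intro c hc
  rw [AsympNum.algebraMap_eq, AsympNum.mk_eq_zero] at hc
  exact eq_zero_of_ae_norm_le U ((hc 1).mono fun φ h => by simpa using h.le)

theorem stdEmb_injective : Function.Injective (stdEmb U Ω) := by
  rw [injective_iff_map_eq_zero]
  intro f hf
  rw [stdEmb, AlgHom.comp_apply, AsympFun.mk_eq_zero] at hf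
  ext x
  refine eq_zero_of_ae_norm_le U ((hf {(x : Eucl d)} isCompact_singleton
    (Set.singleton_subset_iff.2 x.2) 0 1).mono fun φ h => ?_)
  have h1 := h x rfl
  simp only [SmoothFn.deriv_zero, pow_one] at h1
  exact h1

theorem distEmb_injective : Function.Injective (fun T : Distr Ω => distEmb U T) := by
  intro S T hST
  ext τ
  refine algebraMap_asympNum_injective U ?_
  rw [pairing_distEmb, pairing_distEmb]
  exact congrArg _ hST

theorem stdEmb_deriv (α : Fin d → ℕ) (f : SmoothFn Ω) :
    stdEmb U Ω (SmoothFn.deriv α f) = AsympFun.deriv α (stdEmb U Ω f) :=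
  map_multiIter (fun j f => (AsympFun.partialDeriv_mk j (constNet U Ω f)).symm) α f

end Injectivity

end AsymptoticFunctions

end

theorem theorem5p3 {d : ℕ} [NeZero d] (U : DirectingUltrafilter d) (Ω : Opens (Eucl d)) :
    -- the embedding is well defined: the net of regularizations is smooth and moderate
    (∀ T : Distr Ω, ∃ F : moderateFun U Ω,
      (∀ (φ : TestFn d) (x : Ω),
        (((F : TestFn d → SmoothFn Ω) φ : SmoothFn Ω) : Ω → ℂ) x = regularize T φ x) ∧
      distEmb U T = AsympFun.mk F) ∧
    -- (i) smooth functions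
    ((∀ f : SmoothFn Ω, locEmb U (SmoothFn.toLocInt f) = stdEmb U Ω f) ∧
      (∃ A : Subalgebra ℂ (AsympFun U Ω),
        (A : Set (AsympFun U Ω)) =
          Set.range (fun f : SmoothFn Ω => locEmb U (SmoothFn.toLocInt f)) ∧
        (∀ (α : Fin d → ℕ) (a : AsympFun U Ω), a ∈ A → AsympFun.deriv α a ∈ A) ∧
        ∃ e : SmoothFn Ω ≃ₐ[ℂ] A,
          (∀ f : SmoothFn Ω, (e f : AsympFun U Ω) = locEmb U (SmoothFn.toLocInt f)) ∧
          (∀ (α : Fin d → ℕ) (f : SmoothFn Ω),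
            (e (SmoothFn.deriv α f) : AsympFun U Ω) = AsympFun.deriv α (e f : AsympFun U Ω))) ∧
      (∀ (f : SmoothFn Ω) (τ : 𝓓(Ω, ℂ)),
        algebraMap ℂ (AsympNum U)
            (∫ x in (Ω : Set (Eucl d)), zeroExt (f : Ω → ℂ) x * τ x) =
          AsympFun.pairing τ (stdEmb U Ω f) ∧
        algebraMap ℂ (AsympNum U)
            (∫ x in (Ω : Set (Eucl d)), zeroExt (f : Ω → ℂ) x * τ x) =
          AsympFun.pairing τ (locEmb U (SmoothFn.toLocInt f))) ∧
      Function.Injective (stdEmb U Ω) ∧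
      Function.Injective (fun f : SmoothFn Ω => locEmb U (SmoothFn.toLocInt f))) ∧
    -- (ii) distributions
    (IsLinearMap ℂ (fun T : Distr Ω => distEmb U T) ∧
      (∀ (α : Fin d → ℕ) (T : Distr Ω),
        distEmb U (Distr.deriv α T) = AsympFun.deriv α (distEmb U T)) ∧
      (∀ (T : Distr Ω) (τ : 𝓓(Ω, ℂ)),
        algebraMap ℂ (AsympNum U) (T τ) = AsympFun.pairing τ (distEmb U T)) ∧
      Function.Injective (fun T : Distr Ω => distEmb U T)) ∧
    -- (iii) locally integrable functions
    (IsLinearMap ℂ (fun f : LocInt Ω => locEmb U f) ∧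
      (∀ (f : LocInt Ω) (τ : 𝓓(Ω, ℂ)),
        algebraMap ℂ (AsympNum U) (∫ x in (Ω : Set (Eucl d)),
            (f : Eucl d →ₘ[volume.restrict (Ω : Set (Eucl d))] ℂ) x * τ x) =
          AsympFun.pairing τ (locEmb U f)) ∧
      Function.Injective (fun f : LocInt Ω => locEmb U f)) ∧
    -- (iv) restriction to open subsets
    (∀ (O : Opens (Eucl d)) (hO : O ≤ Ω),
      (∀ f : SmoothFn Ω,
        AsympFun.restrict hO (stdEmb U Ω f) = stdEmb U O (SmoothFn.restrict hO f)) ∧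
      (∀ T : Distr Ω,
        AsympFun.restrict hO (distEmb U T) = distEmb U (Distr.restrict hO T)) ∧
      (∀ f : LocInt Ω,
        AsympFun.restrict hO (locEmb U f) = locEmb U (LocInt.restrict hO f))) := by
  refine ⟨fun T => ⟨regNet U T, regFn_eq_regularize T, distEmb_eq_mk U T⟩,
    ⟨locEmb_toLocInt U, ?_, fun f τ => ?_, stdEmb_injective U, ?_⟩,
    ⟨isLinearMap_distEmb U, distEmb_deriv U, pairing_distEmb U, distEmb_injective U⟩,
    ⟨⟨fun f g => ?_, fun c f => ?_⟩, fun f τ => ?_,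
      (distEmb_injective U).comp schwartzEmb_injective⟩,
    fun O hO => ⟨fun f => rfl, restrict_distEmb U hO, fun f => ?_⟩⟩
  · simp only [locEmb_toLocInt]
    refine ⟨(stdEmb U Ω).range, AlgHom.coe_range _, ?_,
      AlgEquiv.ofInjective (stdEmb U Ω) (stdEmb_injective U), fun f => rfl, stdEmb_deriv U⟩
    rintro α _ ⟨f, rfl⟩
    exact ⟨SmoothFn.deriv α f, stdEmb_deriv U α f⟩
  · rw [locEmb_toLocInt, and_self, ← locEmb_toLocInt, ← schwartzEmb_toLocInt_apply]
    exact pairing_distEmb U _ τ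
  · simpa only [locEmb_toLocInt] using stdEmb_injective U
  · rw [locEmb, isLinearMap_schwartzEmb.map_add]
    exact (isLinearMap_distEmb U).map_add _ _
  · rw [locEmb, isLinearMap_schwartzEmb.map_smul]
    exact (isLinearMap_distEmb U).map_smul _ _
  · rw [← schwartzEmb_apply]
    exact pairing_distEmb U _ τ
  · rw [locEmb, locEmb, schwartzEmb_restrict]
    exact restrict_distEmb U hO _
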